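/- Let $0<\beta\le 1$, $0<\alpha<2$, $d\in\mathbb N$, and let $E_\beta(z)=\sum_{n\ge 0} z^n/\Gamma(\beta n+1)$ be the Mittag-Leffler function. Let $\mu_\beta$ be the Mittag-Leffler measure, i.e. the probability measure on the space $\mathcal S'(\mathbb R)$ of real tempered distributions (with the cylinder $\sigma$-algebra) such that $$\int_{\mathcal S'(\mathbb R)} e^{i\langle\omega,\varphi\rangle}\,d\mu_\beta(\omega)=E_\beta\!\left(-\tfrac12\int_{\mathbb R}\varphi(x)^2\,dx\right),\qquad \varphi\in\mathcal S(\mathbb R),$$ and let $\mu_\beta^{\otimes d}$ be its $d$-fold product on $\mathcal S_d'(\mathbb R)=\mathcal S'(\mathbb R)^d$. For $\eta\in L^2(\mathbb R)$ let $\langle\cdot,\eta\rangle$ denote the limit in $L^2(\mu_\beta)$ of $\langle\cdot,\varphi\rangle$ as $\varphi\in\mathcal S(\mathbb R)$ tends to $\eta$ in $L^2(\mathbb R)$. Put $K_{\alpha/2}=\sqrt{\alpha\sin(\alpha\pi/2)\Gamma(\alpha)}$ and $$M^{\alpha/2}_-f=\begin{cases}K_{\alpha/2}\,D_-^{(1-\alpha)/2}f,&0<\alpha<1,\\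 f,&\alpha=1,\\ K_{\alpha/2}\,I_-^{(\alpha-1)/2}f,&1<\alpha<2,\end{cases}$$ where $(I^r_-f)(x)=\frac1{\Gamma(r)}\int_x^\infty f(u)(u-x)^{r-1}\,du$ is the Riemann-Liouville fractional integral and $(D^r_-f)(x)=\lim_{\varepsilon\downarrow0}\frac{r}{\Gamma(1-r)}\int_\varepsilon^\infty\frac{f(x)-f(x+u)}{u^{1+r}}\,du$ is the Marchaud fractional derivative. The vector-valued generalized grey Brownian motion (vggBm) $B^{\beta,\alpha}_d=(B^{\beta,\alpha}_{d,t})_{t\ge0}$ is the $\mathbb R^d$-valued process on $(\mathcal S_d'(\mathbb R),\mu_\beta^{\otimes d})$ given by $$B^{\beta,\alpha}_{d,t}(\omega)=\big(\langle\omega_1,M^{\alpha/2}_-\mathbf 1_{[0,t)}\rangle,\dots,\langle\omega_d,M^{\alpha/2}_-\mathbf 1_{[0,t)}\rangle\big).$$ Then the following hold, with $\mathbb E$ the expectation with respect to $\mu_\beta^{\otimes d}$. (i) For all $t\ge0$ and $p\in\mathbb R^d$, $\displaystyle \mathbb E\big(e^{i(p,B^{\beta,\alpha}_{d,t})}\big)=\prod_{k=1}^dE_\beta\!\left(-\tfrac{p_k^2}{2}\,t^\alpha\right)$.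 (ii) For each $t\ge0$, $B^{\beta,\alpha}_{d,t}$ is square integrable with expectation zero, and for all $i,j=1,\dots,d$ and $t,s\ge0$, $$\mathbb E\big((B^{\beta,\alpha}_{d,t})_i\,(B^{\beta,\alpha}_{d,s})_j\big)=\frac{1}{2\,\Gamma(\beta+1)}\,\delta_{i,j}\,\big(t^\alpha+s^\alpha-|t-s|^\alpha\big).$$ In particular, for each $t\ge0$ the covariance matrix of $B^{\beta,\alpha}_{d,t}$ is $\frac{t^\alpha}{\Gamma(\beta+1)}I_d$. (iii) For each $t\ge0$, the components of $B^{\beta,\alpha}_{d,t}$ are independent. (iv) $B^{\beta,\alpha}_d$ is $\alpha/2$-self-similar with stationary increments in the strict sense: for every $a>0$ the processes $(B^{\beta,\alpha}_{d,at})_{t\ge0}$ and $(a^{\alpha/2}B^{\beta,\alpha}_{d,t})_{t\ge0}$ have the same finite-dimensional distributions, and for every $h\ge0$ the processes $(B^{\beta,\alpha}_{d,t+h}-B^{\beta,\alpha}_{d,h})_{t\ge0}$ and $(B^{\beta,\alpha}_{d,t}-B^{\beta,\alpha}_{d,0})_{t\ge0}$ have the same finite-dimensional distributions. -/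

import Mathlib

open MeasureTheory ProbabilityTheory Filter Topology
open scoped SchwartzMap NNReal

noncomputable section

namespace VGGBM

/-- The Mittag-Leffler function `E_β(z) = ∑ zⁿ / Γ(βn + 1)`. -/
def mittagLeffler (β : ℝ) (z : ℂ) : ℂ :=
  ∑' n : ℕ, z ^ n / (Real.Gamma (β * n + 1) : ℂ)

/-- The space `S'(ℝ)` of real tempered distributions on the real line. -/
abbrev TemperedDual : Type := 𝓢(ℝ, ℝ) →L[ℝ] ℝ

/-- The cylinder σ-algebra on `S'(ℝ)`, generated by the pairings `ω ↦ ⟨ω, φ⟩`. -/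
instance TemperedDual.instCylinder : MeasurableSpace TemperedDual :=
  ⨆ φ : 𝓢(ℝ, ℝ), MeasurableSpace.comap (fun ω : TemperedDual => ω φ) (borel ℝ)

/-- `μ` is the Mittag-Leffler measure `μ_β`: the probability measure on `S'(ℝ)` whose
characteristic function is `φ ↦ E_β(-⟨φ, φ⟩ / 2)`. -/
structure IsMittagLefflerMeasure (β : ℝ) (μ : Measure TemperedDual) : Prop where
  isProbabilityMeasure : IsProbabilityMeasure μ
  charFun_eq : ∀ φ : 𝓢(ℝ, ℝ),
    ∫ ω : TemperedDual, Complex.exp (Complex.I * (ω φ : ℂ)) ∂μ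
      = mittagLeffler β (((-(1 / 2) * ∫ x : ℝ, φ x * φ x : ℝ)) : ℂ)

open Classical in
/-- The class in `L²(m)` of a square integrable function (and `0` for any other function). -/
def classL2 {Ω : Type*} [MeasurableSpace Ω] (m : Measure Ω) (f : Ω → ℝ) : Lp ℝ 2 m :=
  if h : MemLp f 2 m then h.toLp f else 0

/-- The random variable `⟨·, η⟩` for `η ∈ L²(ℝ)`: the limit in `L²(μ)` of `⟨·, φ⟩` as the Schwartz
function `φ` tends to `η` in `L²(ℝ)`. -/
def pairingL2 (μ : Measure TemperedDual) (η : Lp ℝ 2 (volume : Measure ℝ)) : Lp ℝ 2 μ :=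
  limUnder (comap (fun φ : 𝓢(ℝ, ℝ) => φ.toLp 2 (volume : Measure ℝ)) (𝓝 η))
    (fun φ : 𝓢(ℝ, ℝ) => classL2 μ (fun ω : TemperedDual => ω φ))

/-- The Riemann-Liouville fractional integral
`(I^r_- f)(x) = Γ(r)⁻¹ ∫_x^∞ f(u) (u - x)^(r - 1) du`. -/
def riemannLiouvilleMinus (r : ℝ) (f : ℝ → ℝ) (x : ℝ) : ℝ :=
  1 / Real.Gamma r * ∫ u in Set.Ioi x, f u * (u - x) ^ (r - 1)

/-- The Marchaud fractional derivative
`(D^r_- f)(x) = lim_{ε ↓ 0} r / Γ(1 - r) ∫_ε^∞ (f(x) - f(x + u)) / u^(1 + r) du`. -/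
def marchaudMinus (r : ℝ) (f : ℝ → ℝ) (x : ℝ) : ℝ :=
  limUnder (𝓝[>] (0 : ℝ)) fun ε : ℝ =>
    r / Real.Gamma (1 - r) * ∫ u in Set.Ioi ε, (f x - f (x + u)) / u ^ (1 + r)

/-- The normalising constant `K_{α/2} = √(α sin(απ/2) Γ(α))`. -/
def normConst (α : ℝ) : ℝ := √(α * Real.sin (α * Real.pi / 2) * Real.Gamma α)

/-- The operator `M^{α/2}_-`. -/
def fracM (α : ℝ) (f : ℝ → ℝ) (x : ℝ) : ℝ :=
  if α < 1 then normConst α * marchaudMinus ((1 - α) / 2) f x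
  else if α = 1 then f x
  else normConst α * riemannLiouvilleMinus ((α - 1) / 2) f x

/-- `M^{α/2}_- 1_{[0,t)}` as an element of `L²(ℝ)`. -/
def fracMIndicator (α : ℝ) (t : ℝ≥0) : Lp ℝ 2 (volume : Measure ℝ) :=
  classL2 volume (fracM α ((Set.Ico 0 (t : ℝ)).indicator fun _ => 1))

/-- The product measure `μ^{⊗d}` on `S'_d(ℝ) = S'(ℝ)^d`. -/
def productMeasure (d : ℕ) (μ : Measure TemperedDual) : Measure (Fin d → TemperedDual) :=
  Measure.pi fun _ => μ

/-- The vector-valued process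
`t ↦ B_t(ω) = (⟨ω₁, M^{α/2}_- 1_{[0,t)}⟩, …, ⟨ω_d, M^{α/2}_- 1_{[0,t)}⟩)` on `S'_d(ℝ)` with the
measure `μ^{⊗d}`. It is the vector-valued generalized grey Brownian motion `B^{β,α}_d` when `μ` is
the Mittag-Leffler measure `μ_β`. -/
def vggBm (d : ℕ) (μ : Measure TemperedDual) (α : ℝ) (t : ℝ≥0) (ω : Fin d → TemperedDual) :
    EuclideanSpace ℝ (Fin d) :=
  WithLp.toLp 2 fun k => (pairingL2 μ (fracMIndicator α t) : TemperedDual → ℝ) (ω k)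

/-- `X` is self-similar with index `H`: for every `a > 0` the processes `(X_{at})_t` and
`(a^H X_t)_t` have the same finite-dimensional distributions. -/
def IsSelfSimilar {Ω E : Type*} [MeasurableSpace Ω] [AddCommGroup E] [Module ℝ E]
    [MeasurableSpace E] (H : ℝ) (X : ℝ≥0 → Ω → E) (P : Measure Ω) : Prop :=
  ∀ a : ℝ≥0, 0 < a → ∀ (n : ℕ) (t : Fin n → ℝ≥0),
    IdentDistrib (fun ω r => X (a * t r) ω) (fun ω r => ((a : ℝ) ^ H) • X (t r) ω) P P

/-- `X` has stationary increments in the strict sense: for every `h ≥ 0` the processes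
`(X_{t+h} - X_h)_t` and `(X_t - X_0)_t` have the same finite-dimensional distributions. -/
def HasStationaryIncrements {Ω E : Type*} [MeasurableSpace Ω] [AddCommGroup E]
    [MeasurableSpace E] (X : ℝ≥0 → Ω → E) (P : Measure Ω) : Prop :=
  ∀ (h : ℝ≥0) (n : ℕ) (t : Fin n → ℝ≥0),
    IdentDistrib (fun ω r => X (t r + h) ω - X h ω) (fun ω r => X (t r) ω - X 0 ω) P P

end VGGBM

end

/-!
Two facts carry the proof.

*The pairing.* The characteristic functional of `μ_β` is a function of `‖φ‖` alone. Expanding `E_β`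
at the origin shows that `⟨·, φ⟩` has the second moment `‖φ‖² / Γ(β + 1)`
(`IsMittagLefflerMeasure.memLp_eval`), so that `φ ↦ ⟨·, φ⟩` is a multiple of an isometry and extends
by density to a continuous linear map `pairingCLM` from `L²(ℝ)` to `L²(μ_β)`, whose values are the
limits `pairingL2`. The formula `E(exp(i⟨·, η⟩)) = E_β(-‖η‖² / 2)` passes to all `η ∈ L²(ℝ)`. By
linearity the characteristic function of `(⟨·, η₁⟩, …, ⟨·, ηₙ⟩)` depends only on the Gram matrix of
the `ηᵢ`, hence so does the joint law (`IsMittagLefflerMeasure.identDistrib_of_inner_eq`).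

*The kernel.* The function `M^{α/2}_- 1_{[0,t)}` is the Mandelbrot-Van Ness kernel
`C ((t - x)₊^a - (-x)₊^a)` with `a = (α - 1) / 2` (`fracM_indicator`). Its squared norm is `t^α`:
scaling reduces this to `t = 1`, where an explicit primitive turns the integral of
`((1 + s)^a - s^a)²` over the half-line into an Euler Beta integral, and the reflection formula
identifies the constant. Since increments in `t` are translates, the Gram matrix is
`(t^α + s^α - |t - s|^α) / 2` (`inner_fracMIndicator`).

The moments of the process are read off from this Gram matrix, and its self-similarity and the
stationarity of its increments are identities between Gram matrices. The product measure supplies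
the independence of the components and lets all of this be checked in one coordinate.
-/

namespace VGGBM

/-! ### The Mittag-Leffler function near the origin -/

theorem half_le_Gamma {x : ℝ} (hx : 1 ≤ x) : 1 / 2 ≤ Real.Gamma x := by
  have key : ∀ y : ℝ, 2 ≤ y → 1 ≤ Real.Gamma y := fun y hy => by
    have := Real.Gamma_strictMonoOn_Ici.monotoneOn (Set.mem_Ici.2 le_rfl) (Set.mem_Ici.2 hy) hy
    rwa [Real.Gamma_two] at this
  rcases le_total 2 x with h | h
  · linarith [key x h]
  · have h1 := key (x + 1) (by linarith)
    rw [Real.Gamma_add_one (by linarith)] at h1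
    have := Real.Gamma_pos_of_pos (show 0 < x by linarith)
    nlinarith

theorem mittagLeffler_zero (β : ℝ) : mittagLeffler β 0 = 1 := by
  rw [mittagLeffler, tsum_eq_single 0]
  · simp
  · intro n hn; simp [hn]

/-- The Mittag-Leffler function has the derivative `1 / Γ(β + 1)` at the origin. The bound
`Γ ≥ 1 / 2` on `[1, ∞)` gives the power series a positive radius of convergence. -/
theorem hasDerivAt_mittagLeffler_zero {β : ℝ} (hβ : 0 < β) :
    HasDerivAt (mittagLeffler β) (1 / (Real.Gamma (β + 1) : ℂ)) 0 := by
  set c : ℕ → ℂ := fun n => ((Real.Gamma (β * n + 1) : ℂ))⁻¹ with hc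
  have hcb : ∀ n, ‖c n‖ ≤ 2 := fun n => by
    have h1 : 1 / 2 ≤ Real.Gamma (β * n + 1) :=
      half_le_Gamma (le_add_of_nonneg_left (by positivity))
    have h2 : ‖c n‖ = (Real.Gamma (β * n + 1))⁻¹ := by
      rw [hc, norm_inv, Complex.norm_real, Real.norm_of_nonneg (by linarith)]
    rw [h2]
    exact (inv_anti₀ (by norm_num) h1).trans (by norm_num)
  have hps : HasFPowerSeriesAt (mittagLeffler β) (FormalMultilinearSeries.ofScalars ℂ c) 0 := by
    rw [hasFPowerSeriesAt_iff]
    filter_upwards [Metric.ball_mem_nhds (0 : ℂ) one_pos] with z hz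
    have hz' : ‖z‖ < 1 := by simpa using hz
    have hs : Summable fun n => z ^ n * c n := by
      refine Summable.of_norm_bounded (g := fun n => ‖z‖ ^ n * 2)
        ((summable_geometric_of_lt_one (norm_nonneg _) hz').mul_right 2) fun n => ?_
      rw [norm_mul, norm_pow]
      gcongr
      exact hcb n
    simpa [mittagLeffler, div_eq_mul_inv, hc] using hs.hasSum
  simpa [hc] using hps.hasDerivAt

/-! ### Second moments from the characteristic function -/

/-- `(2m sin(x / 2m))² = 2m² (1 - cos(x / m))` is bounded by `x²` and tends to `x²` as `m → ∞`, so
by Fatou's lemma and dominated convergence the limit of its expectation is the second moment. -/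
theorem memLp_two_of_tendsto {Ω : Type*} [MeasurableSpace Ω] {P : Measure Ω}
    [IsProbabilityMeasure P] {X : Ω → ℝ} (hX : Measurable X) {L : ℝ}
    (h : Tendsto (fun n : ℕ => ∫ ω, (2 * (n + 1 : ℝ) * Real.sin (X ω / (2 * (n + 1 : ℝ)))) ^ 2 ∂P)
      atTop (𝓝 L)) :
    MemLp X 2 P ∧ ∫ ω, X ω ^ 2 ∂P = L := by
  set F : ℕ → Ω → ℝ := fun n ω => (2 * (n + 1 : ℝ) * Real.sin (X ω / (2 * (n + 1 : ℝ)))) ^ 2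
  have hF : ∀ n, Measurable (F n) := fun n => by fun_prop
  have hle : ∀ n ω, F n ω ≤ X ω ^ 2 := fun n ω => by
    have hn : (0 : ℝ) < 2 * (n + 1) := by positivity
    refine sq_le_sq.2 ?_
    rw [abs_mul, abs_of_pos hn]
    calc 2 * (n + 1 : ℝ) * |Real.sin (X ω / (2 * (n + 1 : ℝ)))|
        ≤ 2 * (n + 1 : ℝ) * |X ω / (2 * (n + 1 : ℝ))| :=
          mul_le_mul_of_nonneg_left Real.abs_sin_le_abs hn.le
      _ = |X ω| := by rw [abs_div, abs_of_pos hn]; field_simp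
  have hlim : ∀ ω, Tendsto (fun n => F n ω) atTop (𝓝 (X ω ^ 2)) := fun ω => by
    refine Tendsto.pow ?_ 2
    have hd : HasDerivAt (fun s : ℝ => Real.sin (X ω * s)) (X ω) 0 := by
      simpa using ((hasDerivAt_id (0 : ℝ)).const_mul (X ω)).sin
    have hu : Tendsto (fun n : ℕ => 1 / (2 * ((n : ℝ) + 1))) atTop (𝓝[≠] 0) := by
      refine tendsto_nhdsWithin_iff.2 ⟨?_, Eventually.of_forall fun n => ?_⟩
      · have := (tendsto_one_div_add_atTop_nhds_zero_nat (𝕜 := ℝ)).const_mul (1 / 2)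
        simp only [mul_zero] at this
        refine this.congr fun n => ?_
        field_simp
      · simp only [Set.mem_compl_iff, Set.mem_singleton_iff]
        positivity
    refine ((hasDerivAt_iff_tendsto_slope.1 hd).comp hu).congr fun n => ?_
    simp only [Function.comp, slope_def_field]
    field_simp
    simp
  have hint : ∀ n, Integrable (F n) P := fun n => by
    refine Integrable.of_bound (hF n).aestronglyMeasurable ((2 * (n + 1 : ℝ)) ^ 2)
      (Eventually.of_forall fun ω => ?_)
    rw [Real.norm_of_nonneg (sq_nonneg _), mul_pow]
    exact mul_le_of_le_one_right (by positivity) (Real.sin_sq_le_one _)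
  have hfin : ∫⁻ ω, ENNReal.ofReal (X ω ^ 2) ∂P ≤ ENNReal.ofReal L := by
    calc ∫⁻ ω, ENNReal.ofReal (X ω ^ 2) ∂P
        = ∫⁻ ω, liminf (fun n => ENNReal.ofReal (F n ω)) atTop ∂P :=
          lintegral_congr fun ω =>
            ((ENNReal.continuous_ofReal.tendsto _).comp (hlim ω)).liminf_eq.symm
      _ ≤ liminf (fun n => ∫⁻ ω, ENNReal.ofReal (F n ω) ∂P) atTop :=
          lintegral_liminf_le fun n => (hF n).ennreal_ofReal
      _ = liminf (fun n => ENNReal.ofReal (∫ ω, F n ω ∂P)) atTop := by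
          congr 1; ext n
          rw [ofReal_integral_eq_lintegral_ofReal (hint n)
            (Eventually.of_forall fun ω => sq_nonneg _)]
      _ = ENNReal.ofReal L := ((ENNReal.continuous_ofReal.tendsto _).comp h).liminf_eq
  have hsq : Integrable (fun ω => X ω ^ 2) P := by
    refine ⟨(hX.pow_const 2).aestronglyMeasurable, ?_⟩
    rw [hasFiniteIntegral_iff_ofReal (Eventually.of_forall fun ω => sq_nonneg _)]
    exact hfin.trans_lt ENNReal.ofReal_lt_top
  refine ⟨(memLp_two_iff_integrable_sq hX.aestronglyMeasurable).2 hsq, ?_⟩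
  refine tendsto_nhds_unique (tendsto_integral_of_dominated_convergence (fun ω => X ω ^ 2)
    (fun n => (hF n).aestronglyMeasurable) hsq (fun n => Eventually.of_forall fun ω => ?_)
    (Eventually.of_forall hlim)) h
  rw [Real.norm_of_nonneg (sq_nonneg _)]
  exact hle n ω

/-- The integral `∫ φ²` of a Schwartz function is its squared `L²`-norm. -/
theorem integral_mul_self_eq_norm_sq (φ : 𝓢(ℝ, ℝ)) :
    ∫ x, φ x * φ x = ‖φ.toLp 2 (volume : Measure ℝ)‖ ^ 2 := by
  rw [← real_inner_self_eq_norm_sq, L2.inner_def]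
  refine integral_congr_ae ?_
  filter_upwards [φ.coeFn_toLp 2 (volume : Measure ℝ)] with x hx
  rw [hx]; simp [sq]

theorem measurable_eval (φ : 𝓢(ℝ, ℝ)) : Measurable fun ω : TemperedDual => ω φ := by
  have h : MeasurableSpace.comap (fun ω : TemperedDual => ω φ) (borel ℝ) ≤
      TemperedDual.instCylinder :=
    le_iSup (fun φ : 𝓢(ℝ, ℝ) =>
      MeasurableSpace.comap (fun ω : TemperedDual => ω φ) (borel ℝ)) φ
  have e : (inferInstance : MeasurableSpace ℝ) = borel ℝ := BorelSpace.measurable_eq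
  intro s hs
  refine h _ ⟨s, ?_, rfl⟩
  rw [← e]; exact hs

namespace IsMittagLefflerMeasure

variable {β : ℝ} {μ : Measure TemperedDual}

theorem charFun_smul (hμ : IsMittagLefflerMeasure β μ) (φ : 𝓢(ℝ, ℝ)) (u : ℝ) :
    ∫ ω : TemperedDual, Complex.exp (Complex.I * ((u * ω φ : ℝ) : ℂ)) ∂μ
      = mittagLeffler β ((-(1 / 2) * (u * ‖φ.toLp 2 (volume : Measure ℝ)‖) ^ 2 : ℝ) : ℂ) := by
  have h := hμ.charFun_eq (u • φ)
  simp only [map_smul, smul_eq_mul] at h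
  have e : ∫ x, (u • φ) x * (u • φ) x = (u * ‖φ.toLp 2 (volume : Measure ℝ)‖) ^ 2 := by
    rw [mul_pow, ← integral_mul_self_eq_norm_sq, ← integral_const_mul]
    refine integral_congr_ae (Eventually.of_forall fun x => ?_)
    change u * φ x * (u * φ x) = u ^ 2 * (φ x * φ x)
    ring
  rw [h, e]

/-- The pairings with Schwartz functions are square integrable, and `φ ↦ ⟨·, φ⟩` is, up to the
factor `Γ(β + 1)⁻¹`, an isometry for the `L²`-norms. -/
theorem memLp_eval (hβ : 0 < β) (hμ : IsMittagLefflerMeasure β μ) (φ : 𝓢(ℝ, ℝ)) :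
    MemLp (fun ω : TemperedDual => ω φ) 2 μ ∧
      ∫ ω : TemperedDual, ω φ ^ 2 ∂μ
        = ‖φ.toLp 2 (volume : Measure ℝ)‖ ^ 2 / Real.Gamma (β + 1) := by
  have := hμ.isProbabilityMeasure
  refine memLp_two_of_tendsto (measurable_eval φ) ?_
  set N := ‖φ.toLp 2 (volume : Measure ℝ)‖
  set k : ℝ → ℝ := fun t => (mittagLeffler β ((-(1 / 2) * N ^ 2 * t : ℝ) : ℂ)).re with hk
  -- `k (u ^ 2)` is the expectation of `cos (u ⟨·, φ⟩)`.
  have hd : HasDerivAt k (-(1 / 2) * N ^ 2 / Real.Gamma (β + 1)) 0 := by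
    have h1 : HasDerivAt (fun z : ℂ => mittagLeffler β (((-(1 / 2) * N ^ 2 : ℝ) : ℂ) * z))
        (1 / (Real.Gamma (β + 1) : ℂ) * ((-(1 / 2) * N ^ 2 : ℝ) : ℂ)) ((0 : ℝ) : ℂ) := by
      refine HasDerivAt.comp (h₂ := mittagLeffler β) _ ?_ ?_
      · simpa using hasDerivAt_mittagLeffler_zero hβ
      · simpa only [mul_one] using
          (hasDerivAt_id' ((0 : ℝ) : ℂ)).const_mul (((-(1 / 2) * N ^ 2 : ℝ) : ℂ))
    have h2 := h1.real_of_complex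
    have e : (1 / (Real.Gamma (β + 1) : ℂ) * ((-(1 / 2) * N ^ 2 : ℝ) : ℂ)).re
        = -(1 / 2) * N ^ 2 / Real.Gamma (β + 1) := by
      rw [show 1 / (Real.Gamma (β + 1) : ℂ) * ((-(1 / 2) * N ^ 2 : ℝ) : ℂ)
        = ((-(1 / 2) * N ^ 2 / Real.Gamma (β + 1) : ℝ) : ℂ) by push_cast; ring,
        Complex.ofReal_re]
    rw [e] at h2
    refine h2.congr_of_eventuallyEq (Eventually.of_forall fun t => ?_)
    simp only [hk]; push_cast; rfl
  have hu : Tendsto (fun n : ℕ => (1 / ((n : ℝ) + 1)) ^ 2) atTop (𝓝[≠] 0) := by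
    refine tendsto_nhdsWithin_iff.2 ⟨?_, Eventually.of_forall fun n => ?_⟩
    · simpa using (tendsto_one_div_add_atTop_nhds_zero_nat (𝕜 := ℝ)).pow 2
    · simp only [Set.mem_compl_iff, Set.mem_singleton_iff]
      positivity
  have hs := ((hasDerivAt_iff_tendsto_slope.1 hd).comp hu).const_mul (-2)
  rw [show -2 * (-(1 / 2) * N ^ 2 / Real.Gamma (β + 1)) = N ^ 2 / Real.Gamma (β + 1) by ring] at hs
  refine hs.congr fun n => ?_
  have hn : (n : ℝ) + 1 ≠ 0 := by positivity
  have hcos : ∫ ω : TemperedDual, Real.cos (1 / ((n : ℝ) + 1) * ω φ) ∂μ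
      = k ((1 / ((n : ℝ) + 1)) ^ 2) := by
    have h1 := congrArg Complex.re (hμ.charFun_smul φ (1 / ((n : ℝ) + 1)))
    have hi : Integrable (fun ω : TemperedDual =>
        Complex.exp (Complex.I * ((1 / ((n : ℝ) + 1) * ω φ : ℝ) : ℂ))) μ := by
      refine Integrable.of_bound (C := 1) ?_ (Eventually.of_forall fun ω => ?_)
      · exact (Complex.measurable_exp.comp ((Complex.measurable_ofReal.comp
          ((measurable_eval φ).const_mul _)).const_mul _)).aestronglyMeasurable
      · rw [mul_comm, Complex.norm_exp_ofReal_mul_I]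
    rw [← RCLike.re_eq_complex_re, ← integral_re hi] at h1
    simp only [RCLike.re_eq_complex_re, mul_comm Complex.I, Complex.exp_ofReal_mul_I_re] at h1
    rw [h1, hk]
    simp only
    congr 3
    ring
  simp only [Function.comp, slope_def_field]
  rw [← hcos]
  have hk0 : k 0 = 1 := by simp [hk, mittagLeffler_zero]
  rw [hk0]
  have hsin : ∀ ω : TemperedDual, (2 * ((n : ℝ) + 1) * Real.sin (ω φ / (2 * ((n : ℝ) + 1)))) ^ 2
      = 2 * ((n : ℝ) + 1) ^ 2 * (1 - Real.cos (1 / ((n : ℝ) + 1) * ω φ)) := fun ω => by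
    rw [mul_pow, Real.sin_sq_eq_half_sub,
      show 2 * (ω φ / (2 * ((n : ℝ) + 1))) = 1 / ((n : ℝ) + 1) * ω φ by field_simp]
    ring
  simp_rw [hsin]
  have hci : Integrable (fun ω : TemperedDual => Real.cos (1 / ((n : ℝ) + 1) * ω φ)) μ := 
    Integrable.of_bound (C := 1)
      (Real.measurable_cos.comp ((measurable_eval φ).const_mul _)).aestronglyMeasurable
      (Eventually.of_forall fun ω => Real.abs_cos_le_one _)
  rw [integral_const_mul, integral_sub (integrable_const _) hci]
  simp
  field_simp
  ring

end IsMittagLefflerMeasure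

/-! ### The extension of the pairing to `L²(ℝ)` -/

theorem classL2_of_memLp {Ω : Type*} [MeasurableSpace Ω] {m : Measure Ω} {f : Ω → ℝ}
    (h : MemLp f 2 m) : classL2 m f = h.toLp f := dif_pos h

theorem norm_sq_toLp {Ω : Type*} [MeasurableSpace Ω] {m : Measure Ω} {f : Ω → ℝ}
    (h : MemLp f 2 m) : ‖h.toLp f‖ ^ 2 = ∫ x, f x ^ 2 ∂m := by
  rw [← real_inner_self_eq_norm_sq, L2.inner_def]
  refine integral_congr_ae ?_
  filter_upwards [h.coeFn_toLp] with x hx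
  rw [hx]; simp [sq]

/-- The map `X ↦ E(exp(iX))` is `1`-Lipschitz on `L²` of a probability space. -/
theorem lipschitzWith_integral_exp {Ω : Type*} [MeasurableSpace Ω] (P : Measure Ω)
    [IsProbabilityMeasure P] :
    LipschitzWith 1 fun X : Lp ℝ 2 P => ∫ ω, Complex.exp (Complex.I * (X ω : ℂ)) ∂P := by
  refine LipschitzWith.of_dist_le_mul fun X Y => ?_
  rw [NNReal.coe_one, one_mul, dist_eq_norm, dist_eq_norm]
  have hi : ∀ X : Lp ℝ 2 P,
      Integrable (fun ω => Complex.exp (Complex.I * (X ω : ℂ))) P := fun X => by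
    refine Integrable.of_bound (C := 1) ?_ (Eventually.of_forall fun ω => ?_)
    · exact (Complex.measurable_exp.comp ((Complex.measurable_ofReal.comp
        (Lp.stronglyMeasurable X).measurable).const_mul _)).aestronglyMeasurable
    · rw [mul_comm, Complex.norm_exp_ofReal_mul_I]
  have h1 : Integrable (fun ω => (X - Y) ω) P := (Lp.memLp (X - Y)).integrable (by norm_num)
  rw [← integral_sub (hi X) (hi Y)]
  calc ‖∫ ω, (Complex.exp (Complex.I * (X ω : ℂ)) - Complex.exp (Complex.I * (Y ω : ℂ))) ∂P‖
      ≤ ∫ ω, ‖(X - Y) ω‖ ∂P := by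
        refine norm_integral_le_of_norm_le h1.norm ?_
        filter_upwards [Lp.coeFn_sub X Y] with ω hω
        rw [hω, Pi.sub_apply]
        have e : Complex.exp (Complex.I * (X ω : ℂ)) - Complex.exp (Complex.I * (Y ω : ℂ))
            = Complex.exp (Y ω * Complex.I)
              * (Complex.exp (Complex.I * ((X ω - Y ω : ℝ) : ℂ)) - 1) := by
          rw [mul_sub, mul_one, ← Complex.exp_add]
          push_cast; ring_nf
        rw [e, norm_mul, Complex.norm_exp_ofReal_mul_I, one_mul]
        exact Real.norm_exp_I_mul_ofReal_sub_one_le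
    _ = (eLpNorm (X - Y : Lp ℝ 2 P) 1 P).toReal := by
        rw [integral_norm_eq_lintegral_enorm h1.aestronglyMeasurable,
          eLpNorm_one_eq_lintegral_enorm]
    _ ≤ ‖X - Y‖ := by
        rw [Lp.norm_def]
        refine ENNReal.toReal_mono (Lp.eLpNorm_ne_top _) ?_
        exact eLpNorm_le_eLpNorm_of_exponent_le (by norm_num) (Lp.aestronglyMeasurable _)

namespace IsMittagLefflerMeasure

variable {β : ℝ} {μ : Measure TemperedDual}

/-- The linear map `φ ↦ ⟨·, φ⟩` from Schwartz functions to `L²(μ_β)`. -/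
noncomputable def evalLp (hβ : 0 < β) (hμ : IsMittagLefflerMeasure β μ) :
    𝓢(ℝ, ℝ) →ₗ[ℝ] Lp ℝ 2 μ where
  toFun φ := (hμ.memLp_eval hβ φ).1.toLp _
  map_add' φ ψ := by
    rw [← MemLp.toLp_add]
    congr 1
    ext ω
    exact map_add ω φ ψ
  map_smul' c φ := by
    rw [RingHom.id_apply, ← MemLp.toLp_const_smul]
    congr 1
    ext ω
    exact map_smul ω c φ

/-- The continuous linear extension of `φ ↦ ⟨·, φ⟩` to `L²(ℝ)`. -/
noncomputable def pairingCLM (hβ : 0 < β) (hμ : IsMittagLefflerMeasure β μ) :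
    Lp ℝ 2 (volume : Measure ℝ) →L[ℝ] Lp ℝ 2 μ :=
  (hμ.evalLp hβ).extendOfNorm (SchwartzMap.toLpCLM ℝ ℝ 2 (volume : Measure ℝ)).toLinearMap

theorem denseRange_toLp : DenseRange fun φ : 𝓢(ℝ, ℝ) => φ.toLp 2 (volume : Measure ℝ) :=
  SchwartzMap.denseRange_toLpCLM (F := ℝ) (μ := (volume : Measure ℝ)) (p := 2) (by norm_num)

theorem norm_evalLp (hβ : 0 < β) (hμ : IsMittagLefflerMeasure β μ) (φ : 𝓢(ℝ, ℝ)) :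
    ‖hμ.evalLp hβ φ‖ ^ 2 = ‖φ.toLp 2 (volume : Measure ℝ)‖ ^ 2 / Real.Gamma (β + 1) := by
  rw [← (hμ.memLp_eval hβ φ).2]
  exact norm_sq_toLp (hμ.memLp_eval hβ φ).1

theorem pairingCLM_toLp (hβ : 0 < β) (hμ : IsMittagLefflerMeasure β μ) (φ : 𝓢(ℝ, ℝ)) :
    hμ.pairingCLM hβ (φ.toLp 2 (volume : Measure ℝ)) = hμ.evalLp hβ φ := by
  have hG : 0 < Real.Gamma (β + 1) := Real.Gamma_pos_of_pos (by linarith)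
  refine LinearMap.extendOfNorm_eq (f := hμ.evalLp hβ)
    (e := (SchwartzMap.toLpCLM ℝ ℝ 2 (volume : Measure ℝ)).toLinearMap) denseRange_toLp
    ⟨√(1 / Real.Gamma (β + 1)), fun φ => ?_⟩ φ
  change _ ≤ _ * ‖φ.toLp 2 (volume : Measure ℝ)‖
  refine le_of_eq ((sq_eq_sq₀ (norm_nonneg _) (by positivity)).1 ?_)
  rw [hμ.norm_evalLp hβ, mul_pow, Real.sq_sqrt (by positivity)]
  ring

/-- The limit that defines `pairingL2` exists, since the filter of Schwartz functions tending to `η`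
is nontrivial and the extension is continuous. -/
theorem pairingL2_eq (hβ : 0 < β) (hμ : IsMittagLefflerMeasure β μ)
    (η : Lp ℝ 2 (volume : Measure ℝ)) : pairingL2 μ η = hμ.pairingCLM hβ η := by
  have hne : (comap (fun φ : 𝓢(ℝ, ℝ) => φ.toLp 2 (volume : Measure ℝ)) (𝓝 η)).NeBot :=
    comap_neBot fun t ht => denseRange_toLp.mem_nhds ht
  refine Tendsto.limUnder_eq ?_
  refine Tendsto.congr (fun φ => ?_)
    (((hμ.pairingCLM hβ).continuous.tendsto η).comp tendsto_comap)
  rw [classL2_of_memLp (hμ.memLp_eval hβ φ).1]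
  exact hμ.pairingCLM_toLp hβ φ

theorem norm_pairingCLM_sq (hβ : 0 < β) (hμ : IsMittagLefflerMeasure β μ)
    (η : Lp ℝ 2 (volume : Measure ℝ)) :
    ‖hμ.pairingCLM hβ η‖ ^ 2 = ‖η‖ ^ 2 / Real.Gamma (β + 1) := by
  refine denseRange_toLp.induction_on
    (p := fun η => ‖hμ.pairingCLM hβ η‖ ^ 2 = ‖η‖ ^ 2 / Real.Gamma (β + 1)) η ?_ fun φ => ?_
  · exact isClosed_eq (by fun_prop) (by fun_prop)
  · rw [hμ.pairingCLM_toLp hβ, hμ.norm_evalLp hβ]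

theorem inner_pairingCLM (hβ : 0 < β) (hμ : IsMittagLefflerMeasure β μ)
    (η ξ : Lp ℝ 2 (volume : Measure ℝ)) :
    inner ℝ (hμ.pairingCLM hβ η) (hμ.pairingCLM hβ ξ) = inner ℝ η ξ / Real.Gamma (β + 1) := by
  rw [real_inner_eq_norm_add_mul_self_sub_norm_mul_self_sub_norm_mul_self_div_two,
    real_inner_eq_norm_add_mul_self_sub_norm_mul_self_sub_norm_mul_self_div_two, ← map_add]
  simp only [← sq, hμ.norm_pairingCLM_sq hβ]
  ring

/-- Along a ray, `E_β` is itself a characteristic function; in particular it is continuous. -/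
theorem continuous_mittagLeffler (hμ : IsMittagLefflerMeasure β μ) {φ : 𝓢(ℝ, ℝ)}
    (hφ : φ.toLp 2 (volume : Measure ℝ) ≠ 0) :
    Continuous fun r : ℝ => mittagLeffler β ((-(1 / 2) * r ^ 2 : ℝ) : ℂ) := by
  have := hμ.isProbabilityMeasure
  have hN : ‖φ.toLp 2 (volume : Measure ℝ)‖ ≠ 0 := norm_ne_zero_iff.2 hφ
  have hc : Continuous fun r : ℝ => ∫ ω : TemperedDual,
      Complex.exp (Complex.I * ((r / ‖φ.toLp 2 (volume : Measure ℝ)‖ * ω φ : ℝ) : ℂ)) ∂μ := by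
    refine continuous_of_dominated (bound := fun _ => 1) (fun r => ?_) (fun r => ?_)
      (integrable_const _) (Eventually.of_forall fun ω => ?_)
    · exact (Complex.measurable_exp.comp ((Complex.measurable_ofReal.comp
        ((measurable_eval φ).const_mul _)).const_mul _)).aestronglyMeasurable
    · exact Eventually.of_forall fun ω => by rw [mul_comm, Complex.norm_exp_ofReal_mul_I]
    · fun_prop
  refine hc.congr fun r => ?_
  rw [hμ.charFun_smul, div_mul_cancel₀ _ hN]

/-- The characteristic function of `⟨·, η⟩` for `η ∈ L²(ℝ)`. -/
theorem integral_exp_pairingCLM (hβ : 0 < β) (hμ : IsMittagLefflerMeasure β μ)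
    (η : Lp ℝ 2 (volume : Measure ℝ)) :
    ∫ ω, Complex.exp (Complex.I * (hμ.pairingCLM hβ η ω : ℂ)) ∂μ
      = mittagLeffler β ((-(1 / 2) * ‖η‖ ^ 2 : ℝ) : ℂ) := by
  have := hμ.isProbabilityMeasure
  have hS : ∀ φ : 𝓢(ℝ, ℝ), ∫ ω, Complex.exp (Complex.I *
      (hμ.pairingCLM hβ (φ.toLp 2 (volume : Measure ℝ)) ω : ℂ)) ∂μ
      = mittagLeffler β ((-(1 / 2) * ‖φ.toLp 2 (volume : Measure ℝ)‖ ^ 2 : ℝ) : ℂ) := fun φ => by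
    have h := hμ.charFun_smul φ 1
    simp only [one_mul] at h
    rw [← h, hμ.pairingCLM_toLp hβ]
    refine integral_congr_ae ?_
    filter_upwards [(hμ.memLp_eval hβ φ).1.coeFn_toLp] with ω hω
    rw [← hω]
    rfl
  by_cases h0 : ∃ φ : 𝓢(ℝ, ℝ), φ.toLp 2 (volume : Measure ℝ) ≠ 0
  · obtain ⟨φ₀, hφ₀⟩ := h0
    refine denseRange_toLp.induction_on (p := fun η =>
      ∫ ω, Complex.exp (Complex.I * (hμ.pairingCLM hβ η ω : ℂ)) ∂μ
        = mittagLeffler β ((-(1 / 2) * ‖η‖ ^ 2 : ℝ) : ℂ)) η ?_ hS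
    exact isClosed_eq
      ((lipschitzWith_integral_exp μ).continuous.comp (hμ.pairingCLM hβ).continuous)
      ((hμ.continuous_mittagLeffler hφ₀).comp continuous_norm)
  -- If all Schwartz functions vanished in `L²(ℝ)`, then by density so would `η`.
  · push Not at h0
    have hη : η = (0 : 𝓢(ℝ, ℝ)).toLp 2 (volume : Measure ℝ) := by
      refine denseRange_toLp.induction_on
        (p := fun η => η = (0 : 𝓢(ℝ, ℝ)).toLp 2 (volume : Measure ℝ)) η
        (isClosed_eq continuous_id continuous_const) fun φ => by rw [h0, h0]
    rw [hη, hS]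

end IsMittagLefflerMeasure

/-! ### Finite-dimensional distributions -/

theorem coeFn_sum_smul {Ω : Type*} [MeasurableSpace Ω] {m : Measure Ω} {ι : Type*} (s : Finset ι)
    (c : ι → ℝ) (X : ι → Lp ℝ 2 m) :
    ((∑ i ∈ s, c i • X i : Lp ℝ 2 m) : Ω → ℝ) =ᵐ[m] fun ω => ∑ i ∈ s, c i * X i ω := by
  classical
  induction s using Finset.induction_on with
  | empty => simp only [Finset.sum_empty]; exact Lp.coeFn_zero ℝ 2 m
  | insert a s ha ih =>
    rw [Finset.sum_insert ha]
    filter_upwards [Lp.coeFn_add (c a • X a) (∑ i ∈ s, c i • X i), Lp.coeFn_smul (c a) (X a), ih]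
      with ω h1 h2 h3
    rw [h1, Pi.add_apply, h2, h3, Finset.sum_insert ha, Pi.smul_apply, smul_eq_mul]

namespace IsMittagLefflerMeasure

variable {β : ℝ} {μ : Measure TemperedDual}

/-- The joint law of finitely many pairings is determined by the Gram matrix of the `L²` functions:
a linear combination of pairings is the pairing with the linear combination, whose characteristic
function depends on its norm only. -/
theorem identDistrib_of_inner_eq (hβ : 0 < β) (hμ : IsMittagLefflerMeasure β μ)
    {ι : Type*} [Fintype ι] {η ξ : ι → Lp ℝ 2 (volume : Measure ℝ)}
    (h : ∀ i j, inner ℝ (η i) (η j) = (inner ℝ (ξ i) (ξ j) : ℝ))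
    {X Y : ι → TemperedDual → ℝ} (hX : ∀ i, X i =ᵐ[μ] hμ.pairingCLM hβ (η i))
    (hY : ∀ i, Y i =ᵐ[μ] hμ.pairingCLM hβ (ξ i)) :
    IdentDistrib (fun ω i => X i ω) (fun ω i => Y i ω) μ μ := by
  classical
  have := hμ.isProbabilityMeasure
  have key : ∀ {η : ι → Lp ℝ 2 (volume : Measure ℝ)} {X : ι → TemperedDual → ℝ},
      (∀ i, X i =ᵐ[μ] hμ.pairingCLM hβ (η i)) → AEMeasurable (fun ω i => X i ω) μ ∧
      ∀ L : StrongDual ℝ (ι → ℝ), charFunDual (μ.map fun ω i => X i ω) L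
        = mittagLeffler β ((-(1 / 2) * ∑ i, ∑ j, L (Pi.single i 1) * (L (Pi.single j 1)
            * inner ℝ (η i) (η j)) : ℝ) : ℂ) := by
    intro η X hX
    have hm : AEMeasurable (fun ω i => X i ω) μ :=
      aemeasurable_pi_lambda _ fun i =>
        (Lp.stronglyMeasurable (hμ.pairingCLM hβ (η i))).measurable.aemeasurable.congr (hX i).symm
    refine ⟨hm, fun L => ?_⟩
    rw [charFunDual_apply, integral_map hm (by fun_prop)]
    set c : ι → ℝ := fun i => L (Pi.single i 1) with hc
    have hL : ∀ x : ι → ℝ, L x = ∑ i, c i * x i := fun x => by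
      conv_lhs => rw [← Finset.univ_sum_single x]
      rw [map_sum]
      refine Finset.sum_congr rfl fun i _ => ?_
      rw [hc, mul_comm, ← smul_eq_mul, ← map_smul, ← Pi.single_smul, smul_eq_mul, mul_one]
    have hnorm : ∑ i, ∑ j, c i * (c j * inner ℝ (η i) (η j)) = ‖∑ i, c i • η i‖ ^ 2 := by
      rw [← real_inner_self_eq_norm_sq, sum_inner]
      simp_rw [inner_sum, inner_smul_left, inner_smul_right]
      rfl
    rw [hnorm, ← hμ.integral_exp_pairingCLM hβ]
    refine integral_congr_ae ?_
    rw [map_sum]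
    simp_rw [map_smul]
    filter_upwards [coeFn_sum_smul Finset.univ c fun i => hμ.pairingCLM hβ (η i),
      eventually_countable_forall.2 hX] with ω h1 h2
    rw [h1, hL, mul_comm]
    simp only [h2]
  refine ⟨(key hX).1, (key hY).1, ?_⟩
  have := Measure.isProbabilityMeasure_map (key hX).1
  have := Measure.isProbabilityMeasure_map (key hY).1
  refine Measure.ext_of_charFunDual ?_
  ext L
  rw [(key hX).2, (key hY).2]
  simp_rw [h]

/-- `⟨·, η⟩` and `-⟨·, η⟩` have the same law, so `⟨·, η⟩` is centred. -/
theorem integral_pairingCLM (hβ : 0 < β) (hμ : IsMittagLefflerMeasure β μ)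
    (η : Lp ℝ 2 (volume : Measure ℝ)) : ∫ ω, hμ.pairingCLM hβ η ω ∂μ = 0 := by
  have hneg : (fun ω => -hμ.pairingCLM hβ η ω) =ᵐ[μ] hμ.pairingCLM hβ (-η) := by
    rw [map_neg]; exact (Lp.coeFn_neg _).symm
  have h := (hμ.identDistrib_of_inner_eq hβ (ι := Unit) (η := fun _ => η) (ξ := fun _ => -η)
    (fun _ _ => (inner_neg_neg _ _).symm) (X := fun _ => hμ.pairingCLM hβ η)
    (fun _ => EventuallyEq.rfl) (fun _ => hneg)).comp (measurable_pi_apply ())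
  have h2 := h.integral_eq
  simp only [Function.comp_def, integral_neg] at h2
  linarith

end IsMittagLefflerMeasure

/-- Equality of joint laws passes to independent copies in the coordinates of a product space. -/
theorem identDistrib_productMeasure {μ : Measure TemperedDual} [IsProbabilityMeasure μ] {n : ℕ}
    {X Y : Fin n → TemperedDual → ℝ}
    (h : IdentDistrib (fun ω r => X r ω) (fun ω r => Y r ω) μ μ) (d : ℕ) :
    IdentDistrib (fun (ω : Fin d → TemperedDual) r => WithLp.toLp 2 fun k => X r (ω k))
      (fun ω r => WithLp.toLp 2 fun k => Y r (ω k))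
      (productMeasure d μ) (productMeasure d μ) := by
  have := Measure.isProbabilityMeasure_map h.aemeasurable_fst
  have := Measure.isProbabilityMeasure_map h.aemeasurable_snd
  have hm : ∀ {Z : Fin n → TemperedDual → ℝ}, AEMeasurable (fun ω r => Z r ω) μ →
      AEMeasurable (fun (ω : Fin d → TemperedDual) k r => Z r (ω k)) (VGGBM.productMeasure d μ) :=
    fun hZ => aemeasurable_pi_lambda _ fun k =>
      hZ.comp_quasiMeasurePreserving
        (measurePreserving_eval (fun _ : Fin d => μ) k).quasiMeasurePreserving
  have h1 : IdentDistrib (fun (ω : Fin d → TemperedDual) k r => X r (ω k))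
      (fun ω k r => Y r (ω k)) (VGGBM.productMeasure d μ) (VGGBM.productMeasure d μ) := by
    refine ⟨hm h.aemeasurable_fst, hm h.aemeasurable_snd, ?_⟩
    rw [VGGBM.productMeasure, Measure.pi_map_pi (f := fun _ w r => X r w)
      (fun _ => h.aemeasurable_fst), Measure.pi_map_pi (f := fun _ w r => Y r w)
      (fun _ => h.aemeasurable_snd), h.map_eq]
  exact h1.comp (u := fun (z : Fin d → Fin n → ℝ) (r : Fin n) =>
    (WithLp.toLp 2 fun k => z k r : EuclideanSpace ℝ (Fin d))) (by fun_prop)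

/-! ### Euler's Beta integral on the half-line -/

theorem integrableOn_beta {p q : ℝ} (hp : 0 < p) (hq : 0 < q) :
    IntegrableOn (fun x : ℝ => x ^ (p - 1) * (1 - x) ^ (q - 1)) (Set.Ioo 0 1) ∧
      ∫ x in Set.Ioo (0 : ℝ) 1, x ^ (p - 1) * (1 - x) ^ (q - 1) = beta p q := by
  have hc : IntegrableOn (fun x : ℝ => (x : ℂ) ^ ((p : ℂ) - 1) * (1 - (x : ℂ)) ^ ((q : ℂ) - 1))
      (Set.Ioo 0 1) := by
    have h := Complex.betaIntegral_convergent (u := p) (v := q) (by simpa) (by simpa)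
    rw [intervalIntegrable_iff_integrableOn_Ioo_of_le zero_le_one] at h
    exact h
  have he : ∀ x ∈ Set.Ioo (0 : ℝ) 1,
      RCLike.re ((x : ℂ) ^ ((p : ℂ) - 1) * (1 - (x : ℂ)) ^ ((q : ℂ) - 1))
        = x ^ (p - 1) * (1 - x) ^ (q - 1) := fun x hx => by
    have h1 : (x : ℂ) ^ ((p : ℂ) - 1) = ((x ^ (p - 1) : ℝ) : ℂ) := by
      rw [Complex.ofReal_cpow hx.1.le]; push_cast; rfl
    have h2 : (1 - (x : ℂ)) ^ ((q : ℂ) - 1) = (((1 - x) ^ (q - 1) : ℝ) : ℂ) := by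
      rw [Complex.ofReal_cpow (by linarith [hx.2])]; push_cast; rfl
    rw [h1, h2, ← Complex.ofReal_mul]
    exact Complex.ofReal_re _
  refine ⟨(integrableOn_congr_fun he measurableSet_Ioo).1 hc.re, ?_⟩
  rw [← setIntegral_congr_fun measurableSet_Ioo he, integral_re hc,
    beta_eq_betaIntegralReal _ _ hp hq, Complex.betaIntegral,
    intervalIntegral.integral_of_le zero_le_one, integral_Ioc_eq_integral_Ioo]
  rfl

/-- The substitution `x = s / (1 + s)` in the Beta integral. -/
theorem integrableOn_Ioi_beta {p q : ℝ} (hp : 0 < p) (hq : 0 < q) :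
    IntegrableOn (fun s : ℝ => s ^ (p - 1) * (1 + s) ^ (-(p + q))) (Set.Ioi 0) ∧
      ∫ s in Set.Ioi (0 : ℝ), s ^ (p - 1) * (1 + s) ^ (-(p + q)) = beta p q := by
  set f : ℝ → ℝ := fun s => s / (1 + s)
  have hf : ∀ s ∈ Set.Ioi (0 : ℝ), HasDerivWithinAt f (1 / (1 + s) ^ 2) (Set.Ioi 0) s :=
    fun s hs => by
      have hs' : (1 + s) ≠ 0 := by have : 0 < s := hs; positivity
      have h := (hasDerivAt_id' s).div ((hasDerivAt_id' s).const_add 1) hs'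
      refine (h.congr_deriv ?_).hasDerivWithinAt
      ring
  have hinj : Set.InjOn f (Set.Ioi 0) := fun s hs u hu h => by
    have h1 : 0 < s := hs
    have h2 : 0 < u := hu
    simp only [f] at h
    rw [div_eq_div_iff (by positivity) (by positivity)] at h
    linarith
  have himg : f '' Set.Ioi 0 = Set.Ioo 0 1 := by
    ext x
    constructor
    · rintro ⟨s, hs, rfl⟩
      have h1 : 0 < s := hs
      exact ⟨by positivity, by simp only [f]; rw [div_lt_one (by positivity)]; linarith⟩
    · rintro ⟨h0, h1⟩
      have h2 : 0 < 1 - x := by linarith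
      refine ⟨x / (1 - x), Set.mem_Ioi.2 (by positivity), ?_⟩
      simp only [f]
      field_simp
      ring
  have he : ∀ s ∈ Set.Ioi (0 : ℝ),
      |1 / (1 + s) ^ 2| • (f s ^ (p - 1) * (1 - f s) ^ (q - 1))
        = s ^ (p - 1) * (1 + s) ^ (-(p + q)) := fun s hs => by
    have hs' : 0 < s := hs
    have hw : 0 < 1 + s := by positivity
    have h1 : 1 - f s = (1 + s)⁻¹ := by simp only [f]; field_simp; ring
    rw [h1, abs_of_pos (by positivity), smul_eq_mul, Real.div_rpow hs'.le hw.le,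
      Real.inv_rpow hw.le, div_eq_mul_inv (s ^ (p - 1)), ← Real.rpow_neg hw.le,
      ← Real.rpow_neg hw.le, one_div, ← Real.rpow_natCast, ← Real.rpow_neg hw.le]
    rw [mul_left_comm, mul_assoc, mul_left_comm ((1 + s) ^ _), ← Real.rpow_add hw,
      ← Real.rpow_add hw]
    congr 2
    push_cast
    ring
  obtain ⟨h1, h2⟩ := integrableOn_beta hp hq
  rw [← himg] at h1 h2
  rw [integrableOn_image_iff_integrableOn_abs_deriv_smul measurableSet_Ioi hf hinj] at h1
  rw [integral_image_eq_integral_abs_deriv_smul measurableSet_Ioi hf hinj] at h2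
  exact ⟨(integrableOn_congr_fun he measurableSet_Ioi).1 h1,
    (setIntegral_congr_fun measurableSet_Ioi he).symm.trans h2⟩

/-! ### The square integral of the Mandelbrot-Van Ness kernel -/

theorem abs_one_add_rpow_sub_rpow_le {a s : ℝ} (ha : |a| ≤ 1) (hs : 0 < s) :
    |(1 + s) ^ a - s ^ a| ≤ s ^ (a - 1) := by
  have hx : 1 ≤ 1 + s⁻¹ := by have := inv_pos.2 hs; linarith
  have h1 : (1 + s⁻¹) ^ a ≤ 1 + s⁻¹ :=
    (Real.rpow_le_rpow_of_exponent_le hx (abs_le.1 ha).2).trans_eq (Real.rpow_one _)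
  have h2 : 1 - s⁻¹ ≤ (1 + s⁻¹) ^ a := by
    refine le_trans ?_ (Real.rpow_le_rpow_of_exponent_le hx (abs_le.1 ha).1)
    rw [Real.rpow_neg_one, inv_eq_one_div (1 + s⁻¹), le_div_iff₀ (by linarith)]
    nlinarith [sq_nonneg s⁻¹]
  have e : (1 + s) ^ a = s ^ a * (1 + s⁻¹) ^ a := by
    rw [← Real.mul_rpow hs.le (by linarith)]
    congr 1
    field_simp
    ring
  rw [e, Real.rpow_sub_one hs.ne', ← mul_sub_one, abs_mul, abs_of_pos (Real.rpow_pos_of_pos hs a),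
    div_eq_mul_inv]
  exact mul_le_mul_of_nonneg_left (abs_le.2 ⟨by linarith, by linarith⟩)
    (Real.rpow_pos_of_pos hs a).le

/-- Adding `(1 - a) ∫₀ˢ u^a (1 + u)^(a - 2) du`, an incomplete Beta integral, gives a primitive of
`(2a + 1) ((1 + s)^a - s^a)²`. -/
noncomputable def kernelPrimitive (a s : ℝ) : ℝ :=
  (1 + s) ^ (2 * a + 1) + s ^ (2 * a + 1) - 2 * (s ^ (a + 1) * (1 + s) ^ a)
    - s ^ (a + 1) * (1 + s) ^ (a - 1)

theorem hasDerivAt_kernelPrimitive {a s : ℝ} (hs : 0 < s) :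
    HasDerivAt (kernelPrimitive a)
      ((2 * a + 1) * ((1 + s) ^ a - s ^ a) ^ 2 - (1 - a) * (s ^ a * (1 + s) ^ (a - 2))) s := by
  have hw : 0 < 1 + s := by positivity
  have d1 : ∀ b : ℝ, HasDerivAt (fun s : ℝ => (1 + s) ^ b) (b * (1 + s) ^ (b - 1)) s := fun b => by
    simpa using ((hasDerivAt_id' s).const_add 1).rpow_const (p := b) (Or.inl hw.ne')
  have d2 : ∀ b : ℝ, HasDerivAt (fun s : ℝ => s ^ b) (b * s ^ (b - 1)) s := fun b =>
    Real.hasDerivAt_rpow_const (Or.inl hs.ne')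
  refine ((((d1 (2 * a + 1)).add (d2 (2 * a + 1))).sub
    (((d2 (a + 1)).mul (d1 a)).const_mul 2)).sub ((d2 (a + 1)).mul (d1 (a - 1)))).congr_deriv ?_
  have e1 : ∀ u : ℝ, 0 < u → u ^ (2 * a) = u ^ a * u ^ a := fun u hu => by
    rw [← Real.rpow_add hu, two_mul]
  rw [show 2 * a + 1 - 1 = 2 * a by ring, show a + 1 - 1 = a by ring,
    show a - 1 - 1 = a - 2 by ring, e1 _ hw, e1 _ hs, Real.rpow_add_one hs.ne',
    Real.rpow_sub_one hw.ne', show a - 2 = a - (2 : ℕ) by norm_num, Real.rpow_sub_natCast hw.ne']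
  field_simp
  ring

theorem kernelPrimitive_zero {a : ℝ} (ha : -(1 / 2) < a) : kernelPrimitive a 0 = 1 := by
  rw [kernelPrimitive, Real.zero_rpow (by linarith), Real.zero_rpow (by linarith)]
  simp

theorem continuousAt_kernelPrimitive_zero {a : ℝ} (ha : -(1 / 2) < a) :
    ContinuousAt (kernelPrimitive a) 0 := by
  have d1 : ∀ b : ℝ, ContinuousAt (fun s : ℝ => (1 + s) ^ b) 0 := fun b =>
    (continuousAt_const.add continuousAt_id).rpow_const (Or.inl (by norm_num))
  have d2 : ∀ b : ℝ, 0 < b → ContinuousAt (fun s : ℝ => s ^ b) 0 := fun b hb =>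
    Real.continuousAt_rpow_const _ _ (Or.inr hb.le)
  exact (((d1 _).add (d2 _ (by linarith))).sub (((d2 _ (by linarith)).mul (d1 _)).const_mul 2)).sub
    ((d2 _ (by linarith)).mul (d1 _))

/-- With `p = (1 + s)^a` and `q = s^a` the primitive is `s (p - q)² + p (p - q) + p q / (1 + s)`,
and `|p - q| ≤ s^(a - 1)`. -/
theorem tendsto_kernelPrimitive {a : ℝ} (ha : -(1 / 2) < a) (ha' : a < 1 / 2) :
    Tendsto (kernelPrimitive a) atTop (𝓝 0) := by
  have hlim : Tendsto (fun s : ℝ => 5 * s ^ (-(1 - 2 * a))) atTop (𝓝 0) := by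
    simpa using (tendsto_rpow_neg_atTop (show 0 < 1 - 2 * a by linarith)).const_mul 5
  refine squeeze_zero_norm' ?_ hlim
  filter_upwards [eventually_ge_atTop 1] with s hs
  have hs0 : 0 < s := by linarith
  have hw : 0 < 1 + s := by linarith
  have hpq := abs_one_add_rpow_sub_rpow_le (a := a) (abs_le.2 ⟨by linarith, by linarith⟩) hs0
  have e1 : ∀ u : ℝ, 0 < u → u ^ (2 * a) = u ^ a * u ^ a := fun u hu => by
    rw [← Real.rpow_add hu, two_mul]
  have eb : s ^ (-(1 - 2 * a)) = s * (s ^ (a - 1)) ^ 2 := by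
    rw [show -(1 - 2 * a) = 2 * a - 1 by ring, Real.rpow_sub_one hs0.ne', e1 _ hs0,
      Real.rpow_sub_one hs0.ne']
    field_simp
  have eq : s ^ a = s * s ^ (a - 1) := by
    rw [Real.rpow_sub_one hs0.ne']
    field_simp
  have eG : kernelPrimitive a s = s * ((1 + s) ^ a - s ^ a) ^ 2
      + (1 + s) ^ a * ((1 + s) ^ a - s ^ a) + (1 + s) ^ a * s ^ a / (1 + s) := by
    rw [kernelPrimitive, Real.rpow_add_one hw.ne', Real.rpow_add_one hs0.ne', e1 _ hw, e1 _ hs0,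
      Real.rpow_add_one hs0.ne', Real.rpow_sub_one hw.ne']
    field_simp
    ring
  have hp0 : 0 < (1 + s) ^ a := Real.rpow_pos_of_pos hw a
  have hq0 : 0 < s ^ a := Real.rpow_pos_of_pos hs0 a
  have hb0 : 0 < s ^ (a - 1) := Real.rpow_pos_of_pos hs0 _
  rw [eb, eG, Real.norm_eq_abs]
  set p := (1 + s) ^ a
  set q := s ^ a
  set b := s ^ (a - 1)
  have hp : p ≤ 2 * (s * b) := by
    have := (abs_le.1 hpq).2
    nlinarith
  have t1 : |s * (p - q) ^ 2| ≤ s * b ^ 2 := by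
    rw [abs_of_nonneg (by positivity)]
    exact mul_le_mul_of_nonneg_left (sq_le_sq' (abs_le.1 hpq).1 (abs_le.1 hpq).2) hs0.le
  have t2 : |p * (p - q)| ≤ 2 * (s * b) * b := by
    rw [abs_mul, abs_of_pos hp0]
    gcongr
  have t3 : |p * q / (1 + s)| ≤ 2 * (s * b) * b := by
    rw [abs_of_pos (by positivity), mul_div_assoc]
    gcongr
    rw [eq, div_le_iff₀ hw]
    nlinarith
  calc _ ≤ |s * (p - q) ^ 2| + |p * (p - q)| + |p * q / (1 + s)| := abs_add_three _ _ _
    _ ≤ s * b ^ 2 + 2 * (s * b) * b + 2 * (s * b) * b := by gcongr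
    _ = 5 * (s * b ^ 2) := by ring

/-- The fundamental theorem of calculus on `(0, ∞)`; the integrand being nonnegative, the limit of
the primitive also gives its integrability. -/
theorem integrableOn_Ioi_kernel_sq {a : ℝ} (ha : -(1 / 2) < a) (ha' : a < 1 / 2) :
    IntegrableOn (fun s : ℝ => ((1 + s) ^ a - s ^ a) ^ 2) (Set.Ioi 0) ∧
      ∫ s in Set.Ioi (0 : ℝ), ((1 + s) ^ a - s ^ a) ^ 2
        = ((1 - a) * beta (a + 1) (1 - 2 * a) - 1) / (2 * a + 1) := by
  obtain ⟨hi, hB⟩ := integrableOn_Ioi_beta (p := a + 1) (q := 1 - 2 * a) (by linarith) (by linarith)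
  simp only [show a + 1 - 1 = a by ring, show -(a + 1 + (1 - 2 * a)) = a - 2 by ring] at hi hB
  set h : ℝ → ℝ := fun s => s ^ a * (1 + s) ^ (a - 2) with hh
  have hc : 0 < 2 * a + 1 := by linarith
  have hint : ∀ s : ℝ, 0 ≤ s → IntervalIntegrable h volume 0 s := fun s hs => by
    rw [intervalIntegrable_iff_integrableOn_Ioc_of_le hs]
    exact hi.mono_set Set.Ioc_subset_Ioi_self
  -- A primitive of the integrand: the derivatives of its two terms combine to the square.
  set g : ℝ → ℝ := fun s =>
    (kernelPrimitive a s + (1 - a) * ∫ u in (0 : ℝ)..s, h u) / (2 * a + 1) with hg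
  have hmeas : Measurable h := by fun_prop
  have hg0 : ContinuousWithinAt g (Set.Ici 0) 0 := by
    have hI : ContinuousWithinAt (fun s => ∫ u in (0 : ℝ)..s, h u) (Set.Ici 0) 0 := by
      have h1 : ContinuousOn (fun s => ∫ u in (0 : ℝ)..s, h u) (Set.Icc 0 1) := by
        have := intervalIntegral.continuousOn_primitive_interval (f := h) (a := 0) (b := 1)
          (μ := volume) (by
            rw [Set.uIcc_of_le zero_le_one, integrableOn_Icc_iff_integrableOn_Ioc]
            exact hi.mono_set Set.Ioc_subset_Ioi_self)
        rwa [Set.uIcc_of_le zero_le_one] at this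
      exact (h1 0 (by simp)).mono_of_mem_nhdsWithin (Icc_mem_nhdsGE one_pos)
    exact (((continuousAt_kernelPrimitive_zero ha).continuousWithinAt).add
      (hI.const_mul (1 - a))).div_const _
  have hgd : ∀ s ∈ Set.Ioi (0 : ℝ), HasDerivAt g (((1 + s) ^ a - s ^ a) ^ 2) s := fun s hs => by
    have hs' : 0 < s := hs
    have hcont : ContinuousAt h s :=
      (Real.continuousAt_rpow_const _ _ (Or.inl hs'.ne')).mul
        ((continuousAt_const.add continuousAt_id).rpow_const
          (Or.inl (by change 1 + s ≠ 0; positivity)))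
    have h1 := intervalIntegral.integral_hasDerivAt_right (hint s hs'.le)
      (hmeas.stronglyMeasurable.stronglyMeasurableAtFilter) hcont
    refine (((hasDerivAt_kernelPrimitive hs').add (h1.const_mul (1 - a))).div_const
      (2 * a + 1)).congr_deriv ?_
    rw [hh]
    field_simp
    ring
  have hglim : Tendsto g atTop (𝓝 ((0 + (1 - a) * beta (a + 1) (1 - 2 * a)) / (2 * a + 1))) := by
    refine ((tendsto_kernelPrimitive ha ha').add (Tendsto.const_mul _ ?_)).div_const _
    rw [← hB]
    exact intervalIntegral_tendsto_integral_Ioi 0 hi tendsto_id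
  refine ⟨integrableOn_Ioi_deriv_of_nonneg hg0 hgd (fun s _ => sq_nonneg _) hglim, ?_⟩
  rw [integral_Ioi_of_hasDerivAt_of_nonneg hg0 hgd (fun s _ => sq_nonneg _) hglim, hg]
  simp only [kernelPrimitive_zero ha, intervalIntegral.integral_same]
  ring

/-- The reflection formula at `a` and at `2a`. -/
theorem Gamma_mul_cos_mul_Gamma (a : ℝ) (ha : -(1 / 2) < a) (ha' : a < 1 / 2) :
    Real.Gamma (1 - 2 * a) * Real.cos (Real.pi * a) * Real.Gamma (2 * a + 1)
      = Real.Gamma (1 - a) * Real.Gamma (a + 1) := by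
  rcases eq_or_ne a 0 with rfl | h0
  · simp
  have hs : Real.sin (Real.pi * a) ≠ 0 := by
    have hpi := Real.pi_pos
    rw [Ne, Real.sin_eq_zero_iff_of_lt_of_lt (by nlinarith) (by nlinarith)]
    exact mul_ne_zero hpi.ne' h0
  have hcos : Real.cos (Real.pi * a) ≠ 0 :=
    (Real.cos_pos_of_mem_Ioo ⟨by nlinarith [Real.pi_pos], by nlinarith [Real.pi_pos]⟩).ne'
  have h1 := Real.Gamma_mul_Gamma_one_sub (2 * a)
  have h2 := Real.Gamma_mul_Gamma_one_sub a
  rw [show Real.pi * (2 * a) = 2 * (Real.pi * a) by ring, Real.sin_two_mul] at h1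
  rw [Real.Gamma_add_one (by simpa using h0), Real.Gamma_add_one h0]
  calc _ = 2 * a * Real.cos (Real.pi * a) * (Real.Gamma (2 * a) * Real.Gamma (1 - 2 * a)) := by ring
    _ = a * (Real.Gamma a * Real.Gamma (1 - a)) := by
      rw [h1, h2, mul_div_assoc', mul_div_assoc', div_eq_div_iff (by positivity) hs]
      ring
    _ = _ := by ring

/-! ### The Mandelbrot-Van Ness kernel -/

/-- The truncated power `y₊^a`. It vanishes at `y = 0` for every `a`; in particular `y₊^0` is the
indicator function of `(0, ∞)`. -/
noncomputable def truncPow (a y : ℝ) : ℝ := if 0 < y then y ^ a else 0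

theorem truncPow_of_pos {a y : ℝ} (hy : 0 < y) : truncPow a y = y ^ a := if_pos hy

theorem truncPow_of_nonpos {a y : ℝ} (hy : y ≤ 0) : truncPow a y = 0 := if_neg hy.not_gt

theorem measurable_truncPow (a : ℝ) : Measurable (truncPow a) :=
  Measurable.ite measurableSet_Ioi (by fun_prop) measurable_const

theorem truncPow_mul {a t y : ℝ} (ht : 0 < t) : truncPow a (t * y) = t ^ a * truncPow a y := by
  rcases lt_or_ge 0 y with hy | hy
  · rw [truncPow_of_pos hy, truncPow_of_pos (by positivity), Real.mul_rpow ht.le hy.le]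
  · rw [truncPow_of_nonpos hy, truncPow_of_nonpos (mul_nonpos_of_nonneg_of_nonpos ht.le hy),
      mul_zero]

/-- The half-line `(0, ∞)` carries the Beta integral, and `(-1, 0]` cancels its boundary term. -/
theorem integrable_truncPow_sq {a : ℝ} (ha : -(1 / 2) < a) (ha' : a < 1 / 2) :
    Integrable (fun y : ℝ => (truncPow a (1 + y) - truncPow a y) ^ 2) ∧
      ∫ y : ℝ, (truncPow a (1 + y) - truncPow a y) ^ 2
        = (1 - a) * beta (a + 1) (1 - 2 * a) / (2 * a + 1) := by
  obtain ⟨hi, hI⟩ := integrableOn_Ioi_kernel_sq ha ha'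
  have hc : 2 * a + 1 ≠ 0 := by linarith
  set f : ℝ → ℝ := fun y => (truncPow a (1 + y) - truncPow a y) ^ 2 with hf
  have e3 : ∀ y ∈ Set.Ioi (0 : ℝ), ((1 + y) ^ a - y ^ a) ^ 2 = f y := fun y hy => by
    have hy' : 0 < y := hy
    simp only [hf]
    rw [truncPow_of_pos hy', truncPow_of_pos (by linarith)]
  have e2 : ∀ y ∈ Set.Ioc (-1 : ℝ) 0, (1 + y) ^ (2 * a) = f y := fun y hy => by
    have hy1 : 0 < 1 + y := by linarith [hy.1]
    simp only [hf]
    rw [truncPow_of_nonpos hy.2, truncPow_of_pos hy1, sub_zero, two_mul, Real.rpow_add hy1, sq]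
  have e1 : ∀ y ∈ Set.Iic (-1 : ℝ), 0 = f y := fun y hy => by
    have hy' : y ≤ -1 := hy
    simp only [hf]
    rw [truncPow_of_nonpos (by linarith), truncPow_of_nonpos (by linarith)]
    simp
  have h3 := (integrableOn_congr_fun e3 measurableSet_Ioi).1 hi
  have h1 : IntegrableOn f (Set.Iic (-1)) :=
    (integrableOn_congr_fun e1 measurableSet_Iic).1 integrableOn_zero
  have hshift : IntervalIntegrable (fun y : ℝ => (1 + y) ^ (2 * a)) volume (-1) 0 := by
    have := (intervalIntegral.intervalIntegrable_rpow' (a := 0) (b := 1)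
      (show -1 < 2 * a by linarith)).comp_add_left 1
    simpa using this
  have h2 : IntegrableOn f (Set.Ioc (-1) 0) := by
    rw [intervalIntegrable_iff_integrableOn_Ioc_of_le (by norm_num)] at hshift
    exact (integrableOn_congr_fun e2 measurableSet_Ioc).1 hshift
  have h12 : IntegrableOn f (Set.Iic 0) := by
    rw [← Set.Iic_union_Ioc_eq_Iic (show (-1 : ℝ) ≤ 0 by norm_num)]
    exact h1.union h2
  have hint : Integrable f := by
    rw [← integrableOn_univ, ← Set.Iic_union_Ioi (a := (0 : ℝ))]
    exact h12.union h3
  refine ⟨hint, ?_⟩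
  have v1 : ∫ y in Set.Iic (-1 : ℝ), f y = 0 := by
    rw [← setIntegral_congr_fun measurableSet_Iic e1]; simp
  have v2 : ∫ y in Set.Ioc (-1 : ℝ) 0, f y = 1 / (2 * a + 1) := by
    rw [← setIntegral_congr_fun measurableSet_Ioc e2,
      ← intervalIntegral.integral_of_le (by norm_num),
      intervalIntegral.integral_comp_add_left (fun y : ℝ => y ^ (2 * a)) 1,
      integral_rpow (Or.inl (by linarith))]
    norm_num [Real.zero_rpow hc]
  have v3 := (setIntegral_congr_fun measurableSet_Ioi e3).symm.trans hI
  rw [← intervalIntegral.integral_Iic_add_Ioi h12 h3,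
    ← Set.Iic_union_Ioc_eq_Iic (show (-1 : ℝ) ≤ 0 by norm_num),
    setIntegral_union (Set.Iic_disjoint_Ioc le_rfl) measurableSet_Ioc h1 h2, v1, v2, v3]
  field_simp
  ring

/-- The normalised Mandelbrot-Van Ness kernel of Hurst index `α / 2`. -/
noncomputable def mvnKernel (α t x : ℝ) : ℝ :=
  normConst α / Real.Gamma ((α + 1) / 2)
    * (truncPow ((α - 1) / 2) (t - x) - truncPow ((α - 1) / 2) (-x))

theorem measurable_mvnKernel (α t : ℝ) : Measurable (mvnKernel α t) := by
  have := measurable_truncPow ((α - 1) / 2)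
  unfold mvnKernel
  fun_prop

/-- The constant `K_{α/2}` normalises the kernel for `t = 1` to have unit norm in `L²(ℝ)`. -/
theorem normConst_sq_mul {α : ℝ} (hα₀ : 0 < α) (hα₂ : α < 2) :
    (normConst α / Real.Gamma ((α + 1) / 2)) ^ 2
      * ((1 - (α - 1) / 2) * beta ((α - 1) / 2 + 1) (1 - 2 * ((α - 1) / 2))
        / (2 * ((α - 1) / 2) + 1)) = 1 := by
  obtain ⟨a, rfl⟩ : ∃ a, α = 2 * a + 1 := ⟨(α - 1) / 2, by ring⟩
  have ha : -(1 / 2) < a := by linarith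
  have ha' : a < 1 / 2 := by linarith
  have hsin : Real.sin ((2 * a + 1) * Real.pi / 2) = Real.cos (Real.pi * a) := by
    rw [← Real.sin_add_pi_div_two]; congr 1; ring
  have hcos : 0 < Real.cos (Real.pi * a) :=
    Real.cos_pos_of_mem_Ioo ⟨by nlinarith [Real.pi_pos], by nlinarith [Real.pi_pos]⟩
  have hG : ∀ {x : ℝ}, 0 < x → 0 < Real.Gamma x := fun h => Real.Gamma_pos_of_pos h
  have g1 := hG (x := a + 1) (by linarith)
  have g2 := hG (x := 1 - 2 * a) (by linarith)
  have g3 := hG (x := 1 - a) (by linarith)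
  have g4 := hG (x := 2 * a + 1) (by linarith)
  have key := Gamma_mul_cos_mul_Gamma a ha ha'
  rw [show (2 * a + 1 - 1) / 2 = a by ring, show (2 * a + 1 + 1) / 2 = a + 1 by ring, normConst,
    hsin, div_pow, Real.sq_sqrt (by positivity), beta,
    show a + 1 + (1 - 2 * a) = (1 - a) + 1 by ring,
    Real.Gamma_add_one (show 1 - a ≠ 0 by linarith)]
  have h1a : 1 - a ≠ 0 := by linarith
  rw [mul_comm Real.pi a] at key ⊢
  field_simp
  linear_combination key

/-- By scaling, the squared `L²`-norm of the kernel is `t ^ α`. -/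
theorem integrable_mvnKernel_sq {α : ℝ} (hα₀ : 0 < α) (hα₂ : α < 2) {t : ℝ} (ht : 0 ≤ t) :
    Integrable (fun x => mvnKernel α t x ^ 2) ∧ ∫ x, mvnKernel α t x ^ 2 = t ^ α := by
  rcases ht.eq_or_lt with rfl | ht
  · simp [mvnKernel, Real.zero_rpow hα₀.ne']
  obtain ⟨hi, hI⟩ := integrable_truncPow_sq (a := (α - 1) / 2) (by linarith) (by linarith)
  have hc := normConst_sq_mul hα₀ hα₂
  rw [← hI] at hc
  set C := normConst α / Real.Gamma ((α + 1) / 2)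
  set f : ℝ → ℝ := fun y => (truncPow ((α - 1) / 2) (1 + y) - truncPow ((α - 1) / 2) y) ^ 2
  have e : (fun x => mvnKernel α t x ^ 2)
      = fun x => C ^ 2 * (t ^ ((α - 1) / 2)) ^ 2 * f (x * (-t⁻¹)) := by
    ext x
    simp only [mvnKernel, f]
    rw [show t - x = t * (1 + x * (-t⁻¹)) by field_simp; ring,
      show -x = t * (x * (-t⁻¹)) by field_simp, truncPow_mul ht, truncPow_mul ht]
    ring
  have hne : -t⁻¹ ≠ 0 := by simpa using ht.ne'
  rw [e]
  refine ⟨(hi.comp_mul_right' hne).const_mul _, ?_⟩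
  rw [integral_const_mul, Measure.integral_comp_mul_right, inv_neg, inv_inv, abs_neg, abs_of_pos ht,
    smul_eq_mul, show C ^ 2 * (t ^ ((α - 1) / 2)) ^ 2 * (t * ∫ y, f y)
      = (C ^ 2 * ∫ y, f y) * ((t ^ ((α - 1) / 2)) ^ 2 * t) by ring, hc, one_mul, sq,
    ← Real.rpow_add ht, ← Real.rpow_add_one ht.ne']
  congr 1
  ring

theorem memLp_mvnKernel {α : ℝ} (hα₀ : 0 < α) (hα₂ : α < 2) {t : ℝ} (ht : 0 ≤ t) :
    MemLp (mvnKernel α t) 2 volume :=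
  (memLp_two_iff_integrable_sq (measurable_mvnKernel α t).aestronglyMeasurable).2
    (integrable_mvnKernel_sq hα₀ hα₂ ht).1

/-- The increments of `t ↦ mvnKernel α t` are translates of its values. -/
theorem mvnKernel_sub (α t s x : ℝ) :
    mvnKernel α t x - mvnKernel α s x = mvnKernel α (t - s) (x - s) := by
  rw [mvnKernel, mvnKernel, mvnKernel, show t - s - (x - s) = t - x by ring,
    show -(x - s) = s - x by ring]
  ring

/-! ### The fractional operators applied to an indicator function -/

theorem indicator_Ico_eq_sub {t : ℝ} (ht : 0 ≤ t) (u : ℝ) :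
    (Set.Ico 0 t).indicator (fun _ => (1 : ℝ)) u
      = (Set.Iio t).indicator 1 u - (Set.Iio 0).indicator 1 u := by
  simp only [Set.indicator_apply, Set.mem_Ico, Set.mem_Iio, Pi.one_apply]
  split_ifs <;> grind

/-- The Riemann-Liouville integral of the indicator function of `(-∞, c)`. -/
theorem integrableOn_indicator_Iio_mul_rpow {r : ℝ} (hr : 0 < r) (c x : ℝ) :
    IntegrableOn (fun u => (Set.Iio c).indicator 1 u * (u - x) ^ (r - 1)) (Set.Ioi x) ∧
      ∫ u in Set.Ioi x, (Set.Iio c).indicator 1 u * (u - x) ^ (r - 1) = truncPow r (c - x) / r := by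
  have e : (fun u => (Set.Iio c).indicator (1 : ℝ → ℝ) u * (u - x) ^ (r - 1))
      = (Set.Iio c).indicator fun u => (u - x) ^ (r - 1) := by
    ext u; simp only [Set.indicator_apply]; split_ifs <;> simp
  rw [e, IntegrableOn, integrable_indicator_iff measurableSet_Iio, IntegrableOn,
    Measure.restrict_restrict measurableSet_Iio, integral_indicator measurableSet_Iio,
    Measure.restrict_restrict measurableSet_Iio, Set.inter_comm, Set.Ioi_inter_Iio]
  rcases le_or_gt c x with h | h
  · rw [Set.Ioo_eq_empty h.not_gt, truncPow_of_nonpos (by linarith)]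
    simp
  · have hI : IntervalIntegrable (fun u => (u - x) ^ (r - 1)) volume x c := by
      have := (intervalIntegral.intervalIntegrable_rpow' (a := 0) (b := c - x)
        (show -1 < r - 1 by linarith)).comp_sub_right x
      simpa using this
    refine ⟨(intervalIntegrable_iff_integrableOn_Ioo_of_le h.le).1 hI, ?_⟩
    rw [← integral_Ioc_eq_integral_Ioo, ← intervalIntegral.integral_of_le h.le,
      intervalIntegral.integral_comp_sub_right (fun u => u ^ (r - 1)),
      integral_rpow (Or.inl (by linarith)), truncPow_of_pos (by linarith), sub_self,
      sub_add_cancel, Real.zero_rpow hr.ne', sub_zero]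

/-- The truncated Marchaud derivative of the indicator function of `(-∞, c)` does not depend on a
sufficiently small truncation. -/
theorem eventually_integrableOn_indicator_Iio_div_rpow {r : ℝ} (hr : 0 < r) (c x : ℝ) :
    ∀ᶠ ε in 𝓝[>] (0 : ℝ),
      IntegrableOn (fun u => ((Set.Iio c).indicator 1 x - (Set.Iio c).indicator 1 (x + u))
        / u ^ (1 + r)) (Set.Ioi ε) ∧
      ∫ u in Set.Ioi ε, ((Set.Iio c).indicator 1 x - (Set.Iio c).indicator 1 (x + u)) / u ^ (1 + r)
        = truncPow (-r) (c - x) / r := by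
  rcases le_or_gt c x with h | h
  · filter_upwards [self_mem_nhdsWithin] with ε hε
    have hε' : 0 < ε := hε
    have e : ∀ u ∈ Set.Ioi ε, (0 : ℝ) = ((Set.Iio c).indicator 1 x
        - (Set.Iio c).indicator 1 (x + u)) / u ^ (1 + r) := fun u hu => by
      have hu' : ε < u := hu
      rw [Set.indicator_of_notMem (by simpa using h),
        Set.indicator_of_notMem (by simp only [Set.mem_Iio]; linarith)]
      simp
    refine ⟨(integrableOn_congr_fun e measurableSet_Ioi).1 integrableOn_zero, ?_⟩
    rw [← setIntegral_congr_fun measurableSet_Ioi e, truncPow_of_nonpos (by linarith)]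
    simp
  · filter_upwards [Ioo_mem_nhdsGT (show 0 < c - x by linarith)] with ε hε
    have e : ∀ u ∈ Set.Ioi ε, (Set.Ici (c - x)).indicator (fun u => u ^ (-(1 + r))) u
        = ((Set.Iio c).indicator 1 x - (Set.Iio c).indicator 1 (x + u)) / u ^ (1 + r) := by
      intro u hu
      have hu' : 0 < u := hε.1.trans hu
      rw [Set.indicator_of_mem (show x ∈ Set.Iio c from h), Pi.one_apply]
      rcases lt_or_ge u (c - x) with h1 | h1
      · rw [Set.indicator_of_notMem (by simpa only [Set.mem_Ici, not_le] using h1),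
          Set.indicator_of_mem (by simp only [Set.mem_Iio]; linarith)]
        simp
      · rw [Set.indicator_of_mem (by simpa using h1),
          Set.indicator_of_notMem (by simp only [Set.mem_Iio]; linarith), Real.rpow_neg hu'.le]
        simp
    have hcx : 0 < c - x := by linarith
    have hsub : Set.Ici (c - x) ∩ Set.Ioi ε = Set.Ici (c - x) :=
      Set.inter_eq_left.2 fun u hu => hε.2.trans_le hu
    constructor
    · rw [← integrableOn_congr_fun e measurableSet_Ioi, IntegrableOn,
        integrable_indicator_iff measurableSet_Ici, IntegrableOn,
        Measure.restrict_restrict measurableSet_Ici, hsub]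
      exact (integrableOn_Ici_iff_integrableOn_Ioi (by simp)).2
        (integrableOn_Ioi_rpow_of_lt (by linarith) hcx)
    · rw [← setIntegral_congr_fun measurableSet_Ioi e, integral_indicator measurableSet_Ici,
        Measure.restrict_restrict measurableSet_Ici, hsub, integral_Ici_eq_integral_Ioi,
        integral_Ioi_rpow_of_lt (by linarith) hcx, truncPow_of_pos hcx,
        show -(1 + r) + 1 = -r by ring, neg_div_neg_eq]

/-- In all three ranges of `α` the operator `M^{α/2}_-` sends `1_{[0,t)}` to the Mandelbrot-Van Ness
kernel, at every point of the line. -/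
theorem fracM_indicator {α : ℝ} (hα₀ : 0 < α) {t : ℝ} (ht : 0 ≤ t) :
    fracM α ((Set.Ico 0 t).indicator fun _ => 1) = mvnKernel α t := by
  ext x
  rw [mvnKernel]
  -- `1_{[0,t)}` is the difference of the indicator functions of `(-∞, t)` and `(-∞, 0)`.
  rcases lt_trichotomy α 1 with h | rfl | h
  · have hr : 0 < (1 - α) / 2 := by linarith
    rw [fracM, if_pos h, div_mul_eq_mul_div, mul_div_assoc]
    congr 1
    refine Tendsto.limUnder_eq (tendsto_const_nhds.congr' ?_)
    filter_upwards [eventually_integrableOn_indicator_Iio_div_rpow hr t x,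
      eventually_integrableOn_indicator_Iio_div_rpow hr 0 x] with ε h1 h2
    have e : ∀ u, ((Set.Ico 0 t).indicator (fun _ => (1 : ℝ)) x
          - (Set.Ico 0 t).indicator (fun _ => 1) (x + u)) / u ^ (1 + (1 - α) / 2)
        = ((Set.Iio t).indicator 1 x - (Set.Iio t).indicator 1 (x + u)) / u ^ (1 + (1 - α) / 2)
          - ((Set.Iio 0).indicator 1 x - (Set.Iio 0).indicator 1 (x + u))
            / u ^ (1 + (1 - α) / 2) := fun u => by
      rw [indicator_Ico_eq_sub ht, indicator_Ico_eq_sub ht]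
      ring
    simp_rw [e]
    rw [integral_sub h1.1 h2.1, h1.2, h2.2, zero_sub, show -((1 - α) / 2) = (α - 1) / 2 by ring,
      show 1 - (1 - α) / 2 = (α + 1) / 2 by ring]
    field_simp
  · rw [fracM, if_neg (lt_irrefl _), if_pos rfl]
    have hn : normConst 1 = 1 := by simp [normConst]
    rw [hn, indicator_Ico_eq_sub ht]
    have e : ∀ y : ℝ, truncPow 0 y = if 0 < y then 1 else 0 := fun y => by simp [truncPow]
    norm_num [e, Set.indicator_apply]
  · have hr : 0 < (α - 1) / 2 := by linarith
    rw [fracM, if_neg h.not_gt, if_neg h.ne', riemannLiouvilleMinus]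
    obtain ⟨h1, h1'⟩ := integrableOn_indicator_Iio_mul_rpow hr t x
    obtain ⟨h2, h2'⟩ := integrableOn_indicator_Iio_mul_rpow hr 0 x
    simp_rw [indicator_Ico_eq_sub ht, sub_mul]
    rw [integral_sub h1 h2, h1', h2', zero_sub, show (α + 1) / 2 = (α - 1) / 2 + 1 by ring,
      Real.Gamma_add_one hr.ne']
    have := (Real.Gamma_pos_of_pos hr).ne'
    field_simp

theorem fracMIndicator_eq {α : ℝ} (hα₀ : 0 < α) (hα₂ : α < 2) (t : ℝ≥0) :
    fracMIndicator α t = (memLp_mvnKernel hα₀ hα₂ t.coe_nonneg).toLp (mvnKernel α t) := by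
  rw [fracMIndicator, fracM_indicator hα₀ t.coe_nonneg,
    classL2_of_memLp (memLp_mvnKernel hα₀ hα₂ t.coe_nonneg)]

/-- The Gram matrix of the functions `M^{α/2}_- 1_{[0,t)}` is the covariance of fractional Brownian
motion: increments of the kernel are translates, so polarisation reduces it to norms. -/
theorem inner_fracMIndicator {α : ℝ} (hα₀ : 0 < α) (hα₂ : α < 2) (t s : ℝ≥0) :
    inner ℝ (fracMIndicator α t) (fracMIndicator α s)
      = 1 / 2 * ((t : ℝ) ^ α + (s : ℝ) ^ α - |(t : ℝ) - (s : ℝ)| ^ α) := by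
  wlog hst : s ≤ t generalizing s t
  · rw [real_inner_comm, this s t (le_of_not_ge hst), abs_sub_comm]
    ring
  have hst' : (0 : ℝ) ≤ t - s := sub_nonneg.2 hst
  obtain ⟨ht, It⟩ := integrable_mvnKernel_sq hα₀ hα₂ t.coe_nonneg
  obtain ⟨hs, Is⟩ := integrable_mvnKernel_sq hα₀ hα₂ s.coe_nonneg
  obtain ⟨hd, Id⟩ := integrable_mvnKernel_sq hα₀ hα₂ hst'
  have h1 : inner ℝ (fracMIndicator α t) (fracMIndicator α s)
      = ∫ x, 1 / 2 * (mvnKernel α t x ^ 2 + mvnKernel α s x ^ 2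
        - mvnKernel α (t - s) (x - s) ^ 2) := by
    rw [L2.inner_def, fracMIndicator_eq hα₀ hα₂, fracMIndicator_eq hα₀ hα₂]
    refine integral_congr_ae ?_
    filter_upwards [(memLp_mvnKernel hα₀ hα₂ t.coe_nonneg).coeFn_toLp,
      (memLp_mvnKernel hα₀ hα₂ s.coe_nonneg).coeFn_toLp] with x h1 h2
    rw [h1, h2, ← mvnKernel_sub, RCLike.inner_apply, conj_trivial]
    ring
  have hts : Integrable fun x => mvnKernel α t x ^ 2 + mvnKernel α s x ^ 2 := ht.add hs
  have hds : Integrable fun x => mvnKernel α (t - s) (x - s) ^ 2 := hd.comp_sub_right (s : ℝ)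
  rw [h1, integral_const_mul, integral_sub hts hds, integral_add ht hs,
    integral_sub_right_eq_self (fun x => mvnKernel α (t - s) x ^ 2), It, Is, Id,
    abs_of_nonneg hst']

theorem norm_fracMIndicator_sq {α : ℝ} (hα₀ : 0 < α) (hα₂ : α < 2) (t : ℝ≥0) :
    ‖fracMIndicator α t‖ ^ 2 = (t : ℝ) ^ α := by
  rw [← real_inner_self_eq_norm_sq, inner_fracMIndicator hα₀ hα₂, sub_self, abs_zero,
    Real.zero_rpow hα₀.ne']
  ring

/-! ### The vector-valued process -/

section VectorProcess

variable {β α : ℝ} {μ : Measure TemperedDual}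

theorem measurePreserving_coord (d : ℕ) (hμ : IsMittagLefflerMeasure β μ) (k : Fin d) :
    MeasurePreserving (fun ω : Fin d → TemperedDual => ω k) (productMeasure d μ) μ := by
  have := hμ.isProbabilityMeasure
  exact measurePreserving_eval (fun _ : Fin d => μ) k

theorem integral_exp_inner_vggBm (hβ : 0 < β) (hα₀ : 0 < α) (hα₂ : α < 2)
    (hμ : IsMittagLefflerMeasure β μ) {d : ℕ} (t : ℝ≥0) (p : EuclideanSpace ℝ (Fin d)) :
    ∫ ω, Complex.exp (Complex.I * ((inner ℝ p (vggBm d μ α t ω) : ℝ) : ℂ)) ∂(productMeasure d μ)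
      = ∏ k : Fin d, mittagLeffler β ((-((p k) ^ 2 / 2) * (t : ℝ) ^ α : ℝ) : ℂ) := by
  have := hμ.isProbabilityMeasure
  have h1 : ∀ ω, Complex.exp (Complex.I * ((inner ℝ p (vggBm d μ α t ω) : ℝ) : ℂ))
      = ∏ k, Complex.exp (Complex.I *
          ((p k * (pairingL2 μ (fracMIndicator α t) : TemperedDual → ℝ) (ω k) : ℝ) : ℂ)) := by
    intro ω
    rw [← Complex.exp_sum, ← Finset.mul_sum, ← Complex.ofReal_sum, PiLp.inner_apply]
    simp only [vggBm, RCLike.inner_apply, conj_trivial, mul_comm]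
  simp_rw [h1]
  rw [productMeasure, integral_fintype_prod_eq_prod (𝕜 := ℂ) (fun k w => Complex.exp (Complex.I *
    ((p k * (pairingL2 μ (fracMIndicator α t) : TemperedDual → ℝ) w : ℝ) : ℂ)))]
  refine Finset.prod_congr rfl fun k _ => ?_
  rw [hμ.pairingL2_eq hβ]
  have h2 := hμ.integral_exp_pairingCLM hβ (p k • fracMIndicator α t)
  rw [norm_smul, mul_pow, norm_fracMIndicator_sq hα₀ hα₂, Real.norm_eq_abs, sq_abs] at h2
  rw [show -(p k ^ 2 / 2) * (t : ℝ) ^ α = -(1 / 2) * (p k ^ 2 * (t : ℝ) ^ α) by ring, ← h2,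
    map_smul]
  refine integral_congr_ae ?_
  filter_upwards [Lp.coeFn_smul (p k) (hμ.pairingCLM hβ (fracMIndicator α t))] with ω hω
  rw [hω, Pi.smul_apply, smul_eq_mul]

theorem memLp_vggBm_apply (hμ : IsMittagLefflerMeasure β μ) {d : ℕ} (t : ℝ≥0) (k : Fin d) :
    MemLp (fun ω => vggBm d μ α t ω k) 2 (productMeasure d μ) :=
  (Lp.memLp (pairingL2 μ (fracMIndicator α t))).comp_measurePreserving
    (measurePreserving_coord d hμ k)

theorem memLp_vggBm (hμ : IsMittagLefflerMeasure β μ) {d : ℕ} (t : ℝ≥0) :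
    MemLp (vggBm d μ α t) 2 (productMeasure d μ) :=
  memLp_piLp_iff.2 fun k => memLp_vggBm_apply hμ t k

theorem integral_comp_coord (hμ : IsMittagLefflerMeasure β μ) {d : ℕ} (k : Fin d)
    {f : TemperedDual → ℝ} (hf : AEStronglyMeasurable f μ) :
    ∫ ω, f (ω k) ∂(productMeasure d μ) = ∫ w, f w ∂μ := by
  have h := measurePreserving_coord d hμ k
  rw [← h.map_eq] at hf
  rw [← integral_map h.aemeasurable hf, h.map_eq]

theorem integral_vggBm_apply (hβ : 0 < β) (hμ : IsMittagLefflerMeasure β μ) {d : ℕ} (t : ℝ≥0)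
    (k : Fin d) : ∫ ω, vggBm d μ α t ω k ∂(productMeasure d μ) = 0 := by
  refine (integral_comp_coord hμ k (Lp.aestronglyMeasurable _)).trans ?_
  rw [hμ.pairingL2_eq hβ, hμ.integral_pairingCLM hβ]

theorem integral_vggBm (hβ : 0 < β) (hμ : IsMittagLefflerMeasure β μ) {d : ℕ} (t : ℝ≥0) :
    ∫ ω, vggBm d μ α t ω ∂(productMeasure d μ) = 0 := by
  have := hμ.isProbabilityMeasure
  have : IsProbabilityMeasure (productMeasure d μ) := by unfold productMeasure; infer_instance
  have hi : Integrable (vggBm d μ α t) (productMeasure d μ) :=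
    (memLp_vggBm hμ t).integrable (by norm_num)
  ext k
  have h := (EuclideanSpace.proj (𝕜 := ℝ) k).integral_comp_comm hi
  exact h.symm.trans (integral_vggBm_apply hβ hμ t k)

theorem iIndepFun_vggBm (hμ : IsMittagLefflerMeasure β μ) {d : ℕ} (t : Fin d → ℝ≥0) :
    iIndepFun (fun (k : Fin d) ω => vggBm d μ α (t k) ω k) (productMeasure d μ) := by
  have := hμ.isProbabilityMeasure
  exact iIndepFun_pi (μ := fun _ : Fin d => μ)
    (X := fun k w => pairingL2 μ (fracMIndicator α (t k)) w)
    fun k => (Lp.stronglyMeasurable _).measurable.aemeasurable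

theorem integral_vggBm_mul (hβ : 0 < β) (hα₀ : 0 < α) (hα₂ : α < 2)
    (hμ : IsMittagLefflerMeasure β μ) {d : ℕ} (i j : Fin d) (t s : ℝ≥0) :
    ∫ ω, vggBm d μ α t ω i * vggBm d μ α s ω j ∂(productMeasure d μ)
      = 1 / (2 * Real.Gamma (β + 1)) * (if i = j then 1 else 0)
          * ((t : ℝ) ^ α + (s : ℝ) ^ α - |(t : ℝ) - (s : ℝ)| ^ α) := by
  by_cases hij : i = j
  · subst hij
    have h1 := integral_comp_coord hμ i (f := fun w =>
      pairingL2 μ (fracMIndicator α t) w * pairingL2 μ (fracMIndicator α s) w)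
      ((Lp.aestronglyMeasurable _).mul (Lp.aestronglyMeasurable _))
    refine h1.trans ?_
    have h2 := hμ.inner_pairingCLM hβ (fracMIndicator α t) (fracMIndicator α s)
    rw [L2.inner_def] at h2
    simp only [RCLike.inner_apply, conj_trivial] at h2
    rw [hμ.pairingL2_eq hβ, hμ.pairingL2_eq hβ]
    simp_rw [mul_comm (hμ.pairingCLM hβ (fracMIndicator α t) _)]
    rw [h2, inner_fracMIndicator hα₀ hα₂, if_true]
    field_simp
  -- Distinct components are independent also at different times.
  · have h := (iIndepFun_vggBm (α := α) hμ fun k => if k = i then t else s).indepFun hij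
    simp only [if_true, if_neg (Ne.symm hij)] at h
    rw [h.integral_fun_mul_eq_mul_integral (memLp_vggBm_apply hμ t i).aestronglyMeasurable
      (memLp_vggBm_apply hμ s j).aestronglyMeasurable, integral_vggBm_apply hβ hμ, if_neg hij]
    ring

theorem covariance_vggBm (hβ : 0 < β) (hα₀ : 0 < α) (hα₂ : α < 2)
    (hμ : IsMittagLefflerMeasure β μ) {d : ℕ} (t : ℝ≥0) :
    (Matrix.of fun i j : Fin d =>
      covariance (fun ω => vggBm d μ α t ω i) (fun ω => vggBm d μ α t ω j) (productMeasure d μ))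
      = ((t : ℝ) ^ α / Real.Gamma (β + 1)) • (1 : Matrix (Fin d) (Fin d) ℝ) := by
  ext i j
  rw [Matrix.of_apply, covariance, integral_vggBm_apply hβ hμ, integral_vggBm_apply hβ hμ]
  simp only [sub_zero]
  rw [integral_vggBm_mul hβ hα₀ hα₂ hμ, sub_self, abs_zero, Real.zero_rpow hα₀.ne',
    Matrix.smul_apply, Matrix.one_apply, smul_eq_mul]
  ring

theorem isSelfSimilar_vggBm (hβ : 0 < β) (hα₀ : 0 < α) (hα₂ : α < 2)
    (hμ : IsMittagLefflerMeasure β μ) (d : ℕ) :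
    IsSelfSimilar (α / 2) (vggBm d μ α) (productMeasure d μ) := by
  have := hμ.isProbabilityMeasure
  intro a ha n t
  have ha' : (0 : ℝ) < a := ha
  refine identDistrib_productMeasure (X := fun r => pairingL2 μ (fracMIndicator α (a * t r)))
    (Y := fun r w => (a : ℝ) ^ (α / 2) * pairingL2 μ (fracMIndicator α (t r)) w) ?_ d
  refine hμ.identDistrib_of_inner_eq hβ (η := fun r => fracMIndicator α (a * t r))
    (ξ := fun r => ((a : ℝ) ^ (α / 2)) • fracMIndicator α (t r)) (fun i j => ?_) (fun r => ?_)
    (fun r => ?_)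
  -- Both Gram matrices are `a ^ α` times the Gram matrix at the times `t r`.
  · have e : ((a : ℝ) ^ (α / 2)) * (a : ℝ) ^ (α / 2) = (a : ℝ) ^ α := by
      rw [← Real.rpow_add ha', add_halves]
    rw [real_inner_smul_left, real_inner_smul_right, ← mul_assoc, e,
      inner_fracMIndicator hα₀ hα₂, inner_fracMIndicator hα₀ hα₂]
    push_cast
    rw [← mul_sub, abs_mul, abs_of_pos ha', Real.mul_rpow ha'.le (t i).coe_nonneg,
      Real.mul_rpow ha'.le (t j).coe_nonneg, Real.mul_rpow ha'.le (abs_nonneg _)]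
    ring
  · rw [hμ.pairingL2_eq hβ]
  · rw [hμ.pairingL2_eq hβ, map_smul]
    filter_upwards [Lp.coeFn_smul ((a : ℝ) ^ (α / 2)) (hμ.pairingCLM hβ (fracMIndicator α (t r)))]
      with w hw
    rw [hw, Pi.smul_apply, smul_eq_mul]

theorem hasStationaryIncrements_vggBm (hβ : 0 < β) (hα₀ : 0 < α) (hα₂ : α < 2)
    (hμ : IsMittagLefflerMeasure β μ) (d : ℕ) :
    HasStationaryIncrements (vggBm d μ α) (productMeasure d μ) := by
  have := hμ.isProbabilityMeasure
  intro h n t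
  have hsub : ∀ u v : ℝ≥0, (fun w => pairingL2 μ (fracMIndicator α u) w
      - pairingL2 μ (fracMIndicator α v) w)
      =ᵐ[μ] hμ.pairingCLM hβ (fracMIndicator α u - fracMIndicator α v) := fun u v => by
    rw [hμ.pairingL2_eq hβ, hμ.pairingL2_eq hβ, map_sub]
    exact (Lp.coeFn_sub _ _).symm
  refine identDistrib_productMeasure (X := fun r w => pairingL2 μ (fracMIndicator α (t r + h)) w
      - pairingL2 μ (fracMIndicator α h) w)
    (Y := fun r w => pairingL2 μ (fracMIndicator α (t r)) w
      - pairingL2 μ (fracMIndicator α 0) w) ?_ d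
  refine hμ.identDistrib_of_inner_eq hβ
    (η := fun r => fracMIndicator α (t r + h) - fracMIndicator α h)
    (ξ := fun r => fracMIndicator α (t r) - fracMIndicator α 0)
    (fun i j => ?_) (fun r => hsub _ _) (fun r => hsub _ _)
  simp only [inner_sub_left, inner_sub_right, inner_fracMIndicator hα₀ hα₂]
  push_cast
  simp only [add_sub_cancel_right, add_sub_add_right_eq_sub, sub_self, sub_zero, zero_sub, abs_neg,
    sub_add_cancel_right, abs_zero, Real.zero_rpow hα₀.ne', NNReal.abs_eq]
  ring

end VectorProcess

end VGGBM

theorem mainTheorem6 (d : ℕ) (β α : ℝ) (hβ₀ : 0 < β) (hβ₁ : β ≤ 1) (hα₀ : 0 < α) (hα₂ : α < 2)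
    (μ : Measure VGGBM.TemperedDual) (hμ : VGGBM.IsMittagLefflerMeasure β μ) :
    -- characteristic function
    (∀ (t : ℝ≥0) (p : EuclideanSpace ℝ (Fin d)),
      ∫ ω, Complex.exp (Complex.I * ((inner ℝ p (VGGBM.vggBm d μ α t ω) : ℝ) : ℂ))
          ∂(VGGBM.productMeasure d μ)
        = ∏ k : Fin d,
            VGGBM.mittagLeffler β ((-((p k) ^ 2 / 2) * (t : ℝ) ^ α : ℝ) : ℂ)) ∧
    -- square integrability, mean, covariance
    (∀ t : ℝ≥0, MemLp (VGGBM.vggBm d μ α t) 2 (VGGBM.productMeasure d μ)) ∧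
    (∀ t : ℝ≥0, ∫ ω, VGGBM.vggBm d μ α t ω ∂(VGGBM.productMeasure d μ) = 0) ∧
    (∀ (i j : Fin d) (t s : ℝ≥0),
      ∫ ω, VGGBM.vggBm d μ α t ω i * VGGBM.vggBm d μ α s ω j ∂(VGGBM.productMeasure d μ)
        = 1 / (2 * Real.Gamma (β + 1)) * (if i = j then 1 else 0)
            * ((t : ℝ) ^ α + (s : ℝ) ^ α - |(t : ℝ) - (s : ℝ)| ^ α)) ∧
    (∀ t : ℝ≥0,
      (Matrix.of fun i j : Fin d =>
          covariance (fun ω => VGGBM.vggBm d μ α t ω i) (fun ω => VGGBM.vggBm d μ α t ω j)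
            (VGGBM.productMeasure d μ))
        = ((t : ℝ) ^ α / Real.Gamma (β + 1)) • (1 : Matrix (Fin d) (Fin d) ℝ)) ∧
    -- independent components
    (∀ t : ℝ≥0,
      iIndepFun (fun (k : Fin d) ω => VGGBM.vggBm d μ α t ω k) (VGGBM.productMeasure d μ)) ∧
    -- self-similarity and stationary increments
    VGGBM.IsSelfSimilar (α / 2) (VGGBM.vggBm d μ α) (VGGBM.productMeasure d μ) ∧
    VGGBM.HasStationaryIncrements (VGGBM.vggBm d μ α) (VGGBM.productMeasure d μ) :=
  ⟨VGGBM.integral_exp_inner_vggBm hβ₀ hα₀ hα₂ hμ, VGGBM.memLp_vggBm hμ,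
    VGGBM.integral_vggBm hβ₀ hμ, VGGBM.integral_vggBm_mul hβ₀ hα₀ hα₂ hμ,
    VGGBM.covariance_vggBm hβ₀ hα₀ hα₂ hμ, fun t => VGGBM.iIndepFun_vggBm hμ fun _ => t,
    VGGBM.isSelfSimilar_vggBm hβ₀ hα₀ hα₂ hμ d,
    VGGBM.hasStationaryIncrements_vggBm hβ₀ hα₀ hα₂ hμ d⟩
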